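/- **Setting.** Let $L=\{L(B): B\in\mathcal B_b(\mathbb R^2)\}$ be a homogeneous Lévy basis on a probability space $(\Omega,\mathcal F,\mathbb P)$, indexed by the bounded Borel sets of $\mathbb R^2$, with characteristic triplet $(\gamma,b,\nu)$: here $\gamma\in\mathbb R$, $b\ge 0$, and $\nu$ is a Lévy measure ($\nu(\{0\})=0$, $\int(1\wedge x^2)\,\nu(dx)<\infty$); for disjoint sets $B_1,B_2,\dots\in\mathcal B_b(\mathbb R^2)$ the variables $L(B_i)$ are independent and, if $\bigcup_i B_i$ is bounded, $L(\bigcup_i B_i)=\sum_i L(B_i)$ almost surely (as a limit of partial sums); and $\mathbb E\,e^{izL(B)}=e^{\mathrm{Leb}(B)\psi(z)}$ for all $B\in\mathcal B_b(\mathbb R^2)$, $z\in\mathbb R$, where $$\psi(z)=i\gamma z-\tfrac12 b^2z^2+\int_{\mathbb R\setminus\{0\}}\bigl(e^{izx}-1-izx\mathbf 1_{|x|\le 1}\bigr)\,\nu(dx).$$ For a Borel set $B$ of finite Lebesgue measure, $L(B)$ denotes the limit in probability of $L(B\cap[-k,k]^2)$ as $k\to\infty$. The Lévy seed $L'$ is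 a random variable with $\mathbb E\,e^{izL'}=e^{\psi(z)}$; assume $\mathrm{Var}(L')=1$. Let $a:[0,\infty)\to[0,\infty)$ be non-increasing, continuous and integrable, and such that $A=\{(r,y): r\le 0,\ 0\le y\le a(-r)\}$ has positive Lebesgue measure. Let $X_t=L(A_t)$, with $A_t=A+(t,0)$, $t\in\mathbb R$, be the trawl process with trawl function $a$. Let $\Delta_n>0$ satisfy $\Delta_n\to0$ and $n\Delta_n\to\infty$ as $n\to\infty$. Put $\bar X_n=\frac1n\sum_{k=0}^{n-1}X_{k\Delta_n}$ and, for $l=0,\dots,n-1$ and $l\Delta_n\le t<(l+1)\Delta_n$, $$\hat a(t)=-\frac1{n\Delta_n}\sum_{k=l}^{n-1}\bigl(X_{(k-l)\Delta_n}-\bar X_n\bigr)\bigl(X_{(k+1)\Delta_n}-X_{k\Delta_n}\bigr).$$ For $g:\mathbb R\to\mathbb R$ set $$\Psi^n_t(g)=\Delta_n\sum_{l=0}^{\lfloor t/\Delta_n\rfloor-1}g(\hat a(l\Delta_n))\quad(0\le t\le(n-1)\Delta_n),\qquad \Psi_t(g)=\int_0^t g(a(s))\,ds .$$ **Theorem 1.**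 Let $g:\mathbb R\to\mathbb R$ be continuous and of polynomial growth of order $q\ge0$, i.e. $|g(x)|\le C(1+|x|^q)$ for all $x\in\mathbb R$ and some $C>0$, and suppose that $\mathbb E(|L'|^{2q\vee4})<\infty$. Then $\Psi^n(g)\to\Psi(g)$ uniformly on compacts in probability: for every $T>0$ and every $\varepsilon>0$, $$\lim_{n\to\infty}\mathbb P\Bigl(\sup_{0\le t\le T}\bigl|\Psi^n_t(g)-\Psi_t(g)\bigr|\ge\varepsilon\Bigr)=0 .$$ -/

import Mathlib

open MeasureTheory ProbabilityTheory Filter Topology Set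
open scoped ENNReal

noncomputable section

namespace Trawl

/-- A Lévy measure on `ℝ`: no mass at the origin and `∫ (1 ∧ x²) ν(dx) < ∞`. -/
def IsLevyMeasure (ν : Measure ℝ) : Prop :=
  ν {0} = 0 ∧ ∫⁻ x, ENNReal.ofReal (min 1 (x ^ 2)) ∂ν < ∞

/-- The characteristic exponent with triplet `(γ, b, ν)`:
`ψ(z) = iγz - b²z²/2 + ∫ (e^{izx} - 1 - izx 1_{|x| ≤ 1}) ν(dx)`. -/
def charExponent (γ b : ℝ) (ν : Measure ℝ) (z : ℝ) : ℂ :=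
  Complex.I * (γ * z : ℝ) - ((1 / 2 * b ^ 2 * z ^ 2 : ℝ) : ℂ) +
    ∫ x : ℝ, (Complex.exp (Complex.I * (z * x : ℝ)) - 1 -
      Complex.I * (z * x : ℝ) * (if |x| ≤ 1 then 1 else 0)) ∂ν

/-- `μ` is the infinitely divisible law with characteristic triplet `(γ, b, ν)`, i.e. the law of
the Lévy seed `L'` of a homogeneous Lévy basis with this triplet. -/
def IsSeedLaw (γ b : ℝ) (ν : Measure ℝ) (μ : Measure ℝ) : Prop :=
  IsProbabilityMeasure μ ∧ ∀ z : ℝ, charFun μ z = Complex.exp (charExponent γ b ν z)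

/-- `L` is a homogeneous Lévy basis on `ℝ²` with characteristic triplet `(γ, b, ν)`: a random
field indexed by the bounded Borel sets (its values at other sets play no role) that is an
independently scattered random measure with the infinitely divisible marginals given by the
triplet. The countable additivity is almost sure convergence of the partial sums; unconditional
summability would be too strong, it fails for Gaussian bases. -/
structure IsLevyBasis {Ω : Type*} [MeasurableSpace Ω] (P : Measure Ω) (γ b : ℝ) (ν : Measure ℝ)
    (L : Set (ℝ × ℝ) → Ω → ℝ) : Prop where
  nonneg : 0 ≤ b
  levyMeasure : IsLevyMeasure ν
  measurable : ∀ B, MeasurableSet B → Bornology.IsBounded B → Measurable (L B)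
  indep : ∀ B : ℕ → Set (ℝ × ℝ), (∀ i, MeasurableSet (B i)) →
    (∀ i, Bornology.IsBounded (B i)) → Pairwise (fun i j => Disjoint (B i) (B j)) →
    iIndepFun (fun i => L (B i)) P
  additive : ∀ B : ℕ → Set (ℝ × ℝ), (∀ i, MeasurableSet (B i)) →
    Bornology.IsBounded (⋃ i, B i) → Pairwise (fun i j => Disjoint (B i) (B j)) →
    ∀ᵐ ω ∂P, Tendsto (fun N : ℕ => ∑ i ∈ Finset.range N, L (B i) ω) atTop
      (𝓝 (L (⋃ i, B i) ω))
  charFun_eq : ∀ B, MeasurableSet B → Bornology.IsBounded B → ∀ z : ℝ,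
    charFun (P.map (L B)) z =
      Complex.exp (((volume B).toReal : ℂ) * charExponent γ b ν z)

/-- `Y` is (a version of) `L(B)` for a Borel set `B` of finite Lebesgue measure, possibly
unbounded: the limit in probability of `L(B ∩ [-k,k]²)`. For bounded `B` this says `Y = L(B)`
almost surely. -/
def IsLevyValue {Ω : Type*} [MeasurableSpace Ω] (P : Measure Ω) (L : Set (ℝ × ℝ) → Ω → ℝ)
    (B : Set (ℝ × ℝ)) (Y : Ω → ℝ) : Prop :=
  TendstoInMeasure P
    (fun k : ℕ => L (B ∩ Icc (-(k : ℝ)) k ×ˢ Icc (-(k : ℝ)) k)) atTop Y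

/-- The trawl set `A = {(r, y) : r ≤ 0, 0 ≤ y ≤ a(-r)}`. -/
def trawlSet (a : ℝ → ℝ) : Set (ℝ × ℝ) := {p | p.1 ≤ 0 ∧ 0 ≤ p.2 ∧ p.2 ≤ a (-p.1)}

/-- The translated trawl set `A_t = A + (t, 0)`. -/
def trawlSetAt (a : ℝ → ℝ) (t : ℝ) : Set (ℝ × ℝ) := (fun p => p + (t, 0)) '' trawlSet a

/-- `a : [0, ∞) → [0, ∞)` is non-increasing, continuous, integrable, and its trawl set has
positive Lebesgue measure. (Values at negative arguments play no role.) -/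
structure IsTrawlFunction (a : ℝ → ℝ) : Prop where
  nonneg : ∀ s, 0 ≤ s → 0 ≤ a s
  antitone : AntitoneOn a (Ici 0)
  continuous : ContinuousOn a (Ici 0)
  integrable : IntegrableOn a (Ici 0)
  nontrivial : 0 < volume (trawlSet a)

/-- `X_t = L(A_t)` for all `t`. -/
def IsTrawlProcess {Ω : Type*} [MeasurableSpace Ω] (P : Measure Ω) (L : Set (ℝ × ℝ) → Ω → ℝ)
    (a : ℝ → ℝ) (X : ℝ → Ω → ℝ) : Prop :=
  ∀ t : ℝ, IsLevyValue P L (trawlSetAt a t) (X t)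

/-- In-fill and long-span sampling: `Δₙ → 0` and `nΔₙ → ∞`. -/
structure IsInfillLongSpan (Δ : ℕ → ℝ) : Prop where
  pos : ∀ n, 0 < Δ n
  infill : Tendsto Δ atTop (𝓝 0)
  longSpan : Tendsto (fun n : ℕ => (n : ℝ) * Δ n) atTop atTop

variable {Ω : Type*}

/-- The sample mean `X̄ₙ = n⁻¹ ∑_{k=0}^{n-1} X_{kΔₙ}`. -/
def sampleMean (X : ℝ → Ω → ℝ) (Δ : ℕ → ℝ) (n : ℕ) (ω : Ω) : ℝ :=
  (1 / (n : ℝ)) * ∑ k ∈ Finset.range n, X (k * Δ n) ω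

/-- The estimator of the trawl function:
`â(t) = -(nΔₙ)⁻¹ ∑_{k=l}^{n-1} (X_{(k-l)Δₙ} - X̄ₙ) (X_{(k+1)Δₙ} - X_{kΔₙ})`
for `lΔₙ ≤ t < (l+1)Δₙ`, that is `l = ⌊t/Δₙ⌋`. -/
def aHat (X : ℝ → Ω → ℝ) (Δ : ℕ → ℝ) (n : ℕ) (t : ℝ) (ω : Ω) : ℝ :=
  -(1 / ((n : ℝ) * Δ n)) * ∑ k ∈ Finset.Ico ⌊t / Δ n⌋₊ n,
    (X (((k : ℝ) - (⌊t / Δ n⌋₊ : ℝ)) * Δ n) ω - sampleMean X Δ n ω) *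
      (X (((k : ℝ) + 1) * Δ n) ω - X ((k : ℝ) * Δ n) ω)

/-- `Ψⁿ_t(g) = Δₙ ∑_{l=0}^{⌊t/Δₙ⌋-1} g(â(lΔₙ))`. It is meant for `0 ≤ t ≤ (n-1)Δₙ`, which
contains any given compact interval `[0, T]` for all large `n`. -/
def PsiHat (X : ℝ → Ω → ℝ) (Δ : ℕ → ℝ) (g : ℝ → ℝ) (n : ℕ) (t : ℝ) (ω : Ω) : ℝ :=
  Δ n * ∑ l ∈ Finset.range ⌊t / Δ n⌋₊, g (aHat X Δ n (l * Δ n) ω)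

/-- `Ψ_t(g) = ∫₀ᵗ g(a(s)) ds`. -/
def Psi (a g : ℝ → ℝ) (t : ℝ) : ℝ := ∫ s in (0 : ℝ)..t, g (a s)

/-- Uniform convergence on compacts in probability: for all `T > 0`,
`sup_{0 ≤ t ≤ T} |Zⁿ_t - Z_t| → 0` in probability. -/
def TendstoUCP [MeasurableSpace Ω] (P : Measure Ω) (Z : ℕ → ℝ → Ω → ℝ) (Z' : ℝ → Ω → ℝ) : Prop :=
  ∀ T : ℝ, 0 < T → ∀ ε : ℝ≥0∞, 0 < ε →
    Tendsto (fun n => P {ω | ε ≤ ⨆ t ∈ Icc (0 : ℝ) T, edist (Z n t ω) (Z' t ω)}) atTop (𝓝 0)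

/-- Polynomial growth of order `q`. -/
def PolyGrowth (f : ℝ → ℝ) (q : ℝ) : Prop :=
  ∃ C : ℝ, 0 < C ∧ ∀ x, |f x| ≤ C * (1 + |x| ^ q)

end Trawl

end

/-!
Let `p = q ∨ 2`. Since `a` is decreasing, a point of the plane lies in `A_{kΔ}` for an interval of
indices `k`, so the sets `A_0, A_Δ, …, A_{nΔ}` cut the plane into cells indexed by the first and
the last sampling time at which they are covered, and `L` gives independent values to the cells.
In these terms the sum of lagged products defining `â` splits into sums over the cells born and
the cells dying at each step. Each of them is, in forward or in reversed time, a martingale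
transform, whose `p`-th moment is controlled by a Rosenthal type inequality, except for the squares
of the dying cells, whose mean is the area lost. The moments of a cell are of the order of its area
because the symmetrized laws of `L` form a convolution semigroup along which absolute moments of
order at least two are superadditive.

Hence `â` minus the normalised lost area tends to zero in `L^p` as `nΔₙ → ∞`, while the normalised
lost area at lag `lΔₙ` tends to `a(lΔₙ)`, uniformly on compacts. Finally
`|g(y) - g(x)| ≤ ε + C |y - x|^p` for `x` in the range of `a`, so that `Ψⁿ(g) - Ψ(g)` is bounded on
`[0, T]` by a Riemann sum error plus the integrated `p`-th power error of `â`, and Markov's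
inequality applies.
-/

open scoped NNReal

namespace Trawl

/-! ### Moments of convolutions -/

section Moments

/-- The absolute moment `∫ |x|^r μ(dx)` of order `r`, as an element of `[0, ∞]`. -/
noncomputable def absMoment (r : ℝ) (μ : Measure ℝ) : ℝ≥0∞ := ∫⁻ x, ‖x‖ₑ ^ r ∂μ

/-- The symmetrization of `μ`: the law of the difference of two independent variables of law `μ`. -/
noncomputable def symmetrization (μ : Measure ℝ) : Measure ℝ := μ ∗ μ.neg

variable {μ ν : Measure ℝ} {r : ℝ}

instance [IsProbabilityMeasure μ] : IsProbabilityMeasure μ.neg :=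
  Measure.isProbabilityMeasure_map measurable_neg.aemeasurable

instance [IsProbabilityMeasure μ] : IsProbabilityMeasure (symmetrization μ) := by
  unfold symmetrization
  infer_instance

theorem neg_conv (μ ν : Measure ℝ) [SFinite μ] [SFinite ν] : (μ ∗ ν).neg = μ.neg ∗ ν.neg :=
  Measure.map_conv_addMonoidHom (negAddMonoidHom : ℝ →+ ℝ) measurable_neg

instance [SFinite μ] : (symmetrization μ).IsNegInvariant where
  neg_eq_self := by
    have : SFinite μ.neg := by unfold Measure.neg; infer_instance
    rw [symmetrization, neg_conv, Measure.neg_neg, Measure.conv_comm]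

theorem symmetrization_conv (μ ν : Measure ℝ) [SFinite μ] [SFinite ν] :
    symmetrization (μ ∗ ν) = symmetrization μ ∗ symmetrization ν := by
  have : SFinite μ.neg := by unfold Measure.neg; infer_instance
  have : SFinite ν.neg := by unfold Measure.neg; infer_instance
  simp only [symmetrization, neg_conv]
  rw [Measure.conv_assoc, ← Measure.conv_assoc ν, Measure.conv_comm ν μ.neg,
    Measure.conv_assoc μ.neg, ← Measure.conv_assoc]

theorem absMoment_conv [SFinite ν] :
    absMoment r (μ ∗ ν) = ∫⁻ x, ∫⁻ y, ‖x + y‖ₑ ^ r ∂ν ∂μ :=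
  Measure.lintegral_conv (by fun_prop)

theorem absMoment_symmetrization [SFinite μ] :
    absMoment r (symmetrization μ) = ∫⁻ x, ∫⁻ y, ‖x - y‖ₑ ^ r ∂μ ∂μ := by
  have : SFinite μ.neg := by unfold Measure.neg; infer_instance
  simp only [symmetrization, absMoment_conv, Measure.neg, sub_eq_add_neg]
  exact lintegral_congr fun x => lintegral_map (by fun_prop) measurable_neg

theorem lintegral_lintegral_add [IsProbabilityMeasure μ] [IsProbabilityMeasure ν] {f g : ℝ → ℝ≥0∞}
    (hg : Measurable g) :
    ∫⁻ x, ∫⁻ y, f x + g y ∂ν ∂μ = ∫⁻ x, f x ∂μ + ∫⁻ y, g y ∂ν := by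
  simp_rw [lintegral_add_right _ hg, lintegral_const, measure_univ, mul_one]
  rw [lintegral_add_right _ measurable_const, lintegral_const, measure_univ, mul_one]

theorem abs_rpow_eq_sq_rpow (r x : ℝ) : |x| ^ r = (x ^ 2) ^ (r / 2) := by
  rw [← sq_abs, ← Real.rpow_natCast_mul (abs_nonneg x)]
  congr 1
  push_cast
  ring

-- For `r = 2` this is the parallelogram law.
theorem two_mul_abs_rpow_add_le (hr : 2 ≤ r) (x y : ℝ) :
    2 * (|x| ^ r + |y| ^ r) ≤ |x + y| ^ r + |x - y| ^ r := by
  simp only [abs_rpow_eq_sq_rpow]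
  have h_superadd := Real.add_rpow_le_rpow_add (sq_nonneg x) (sq_nonneg y)
    (by linarith : 1 ≤ r / 2)
  have h_convex := (convexOn_rpow (by linarith : 1 ≤ r / 2)).2 (mem_Ici.2 (sq_nonneg (x + y)))
    (mem_Ici.2 (sq_nonneg (x - y))) (by norm_num : (0 : ℝ) ≤ 1 / 2)
    (by norm_num : (0 : ℝ) ≤ 1 / 2) (by norm_num)
  simp only [smul_eq_mul] at h_convex
  rw [show 1 / 2 * (x + y) ^ 2 + 1 / 2 * (x - y) ^ 2 = x ^ 2 + y ^ 2 by ring] at h_convex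
  linarith

theorem two_mul_enorm_rpow_add_le (hr : 2 ≤ r) (x y : ℝ) :
    2 * (‖x‖ₑ ^ r + ‖y‖ₑ ^ r) ≤ ‖x + y‖ₑ ^ r + ‖x - y‖ₑ ^ r := by
  have hr0 : 0 ≤ r := by linarith
  simp only [Real.enorm_eq_ofReal_abs, ENNReal.ofReal_rpow_of_nonneg (abs_nonneg _) hr0]
  rw [← ENNReal.ofReal_add (by positivity) (by positivity),
    ← ENNReal.ofReal_add (by positivity) (by positivity), ← ENNReal.ofReal_ofNat 2,
    ← ENNReal.ofReal_mul (by norm_num)]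
  exact ENNReal.ofReal_le_ofReal (two_mul_abs_rpow_add_le hr x y)

theorem absMoment_add_le_absMoment_conv [IsProbabilityMeasure μ] [IsProbabilityMeasure ν]
    [ν.IsNegInvariant] (hr : 2 ≤ r) : absMoment r μ + absMoment r ν ≤ absMoment r (μ ∗ ν) := by
  have h_sub : absMoment r (μ ∗ ν) = ∫⁻ x, ∫⁻ y, ‖x - y‖ₑ ^ r ∂ν ∂μ := by
    rw [absMoment_conv]
    refine lintegral_congr fun x => ?_
    rw [← lintegral_neg_eq_self]
    simp only [sub_eq_add_neg]
  have h_double : 2 * (absMoment r μ + absMoment r ν) ≤ 2 * absMoment r (μ ∗ ν) :=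
    calc 2 * (absMoment r μ + absMoment r ν)
      _ = ∫⁻ x, ∫⁻ y, 2 * ‖x‖ₑ ^ r + 2 * ‖y‖ₑ ^ r ∂ν ∂μ := by
        rw [lintegral_lintegral_add (by fun_prop),
          lintegral_const_mul _ (by fun_prop), lintegral_const_mul _ (by fun_prop), mul_add]
        rfl
      _ ≤ ∫⁻ x, ∫⁻ y, ‖x + y‖ₑ ^ r + ‖x - y‖ₑ ^ r ∂ν ∂μ := by
        refine lintegral_mono fun x => lintegral_mono fun y => ?_
        rw [← mul_add]
        exact two_mul_enorm_rpow_add_le hr x y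
      _ = absMoment r (μ ∗ ν) + absMoment r (μ ∗ ν) := by
        nth_rw 1 [absMoment_conv]
        rw [h_sub, ← lintegral_add_left (Measurable.lintegral_prod_right (by fun_prop))]
        exact lintegral_congr fun x => lintegral_add_left (by fun_prop) _
      _ = 2 * absMoment r (μ ∗ ν) := (two_mul _).symm
  exact (ENNReal.mul_le_mul_iff_right (by norm_num) (by norm_num)).1 h_double

theorem absMoment_conv_lt_top [IsProbabilityMeasure μ] [IsProbabilityMeasure ν] (hr : 1 ≤ r)
    (hμ : absMoment r μ < ∞) (hν : absMoment r ν < ∞) : absMoment r (μ ∗ ν) < ∞ :=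
  calc absMoment r (μ ∗ ν)
    _ ≤ ∫⁻ x, ∫⁻ y, 2 ^ (r - 1) * ‖x‖ₑ ^ r + 2 ^ (r - 1) * ‖y‖ₑ ^ r ∂ν ∂μ := by
      rw [absMoment_conv]
      refine lintegral_mono fun x => lintegral_mono fun y => ?_
      rw [← mul_add]
      exact (ENNReal.rpow_le_rpow (enorm_add_le x y) (by linarith)).trans
        (ENNReal.rpow_add_le_mul_rpow_add_rpow _ _ hr)
    _ = 2 ^ (r - 1) * (absMoment r μ + absMoment r ν) := by
      rw [lintegral_lintegral_add (by fun_prop),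
        lintegral_const_mul _ (by fun_prop), lintegral_const_mul _ (by fun_prop), mul_add]
      rfl
    _ < ∞ := ENNReal.mul_lt_top (by simp [ENNReal.rpow_lt_top_of_nonneg, hr])
      (ENNReal.add_lt_top.2 ⟨hμ, hν⟩)

theorem absMoment_symmetrization_lt_top [IsProbabilityMeasure μ] (hr : 1 ≤ r)
    (hμ : absMoment r μ < ∞) : absMoment r (symmetrization μ) < ∞ := by
  refine absMoment_conv_lt_top hr hμ ?_
  rw [absMoment, Measure.neg, lintegral_map (by fun_prop) measurable_neg]
  simpa only [enorm_neg, absMoment] using hμ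

theorem memLp_ofReal_iff {α : Type*} [MeasurableSpace α] {μ : Measure α} {f : α → ℝ}
    (hf : AEStronglyMeasurable f μ) (hr : 0 < r) :
    MemLp f (ENNReal.ofReal r) μ ↔ ∫⁻ x, ‖f x‖ₑ ^ r ∂μ < ∞ := by
  rw [MemLp, and_iff_right hf, eLpNorm_lt_top_iff_lintegral_rpow_enorm_lt_top
    (by simpa using hr) ENNReal.ofReal_ne_top, ENNReal.toReal_ofReal hr.le]

theorem memLp_id_of_absMoment_symmetrization_lt_top [IsProbabilityMeasure μ] (hr : 0 < r)
    (h : absMoment r (symmetrization μ) < ∞) : MemLp id (ENNReal.ofReal r) μ := by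
  rw [absMoment_symmetrization] at h
  obtain ⟨x, hx⟩ := (ae_lt_top (Measurable.lintegral_prod_right (by fun_prop)) h.ne).exists
  have h_sub : MemLp (fun y => x - y) (ENNReal.ofReal r) μ :=
    (memLp_ofReal_iff (by fun_prop) hr).2 hx
  refine ((memLp_const x).sub h_sub).congr_norm aestronglyMeasurable_id (ae_of_all _ fun y => ?_)
  simp

theorem enorm_integral_rpow_le {α : Type*} [MeasurableSpace α] {μ : Measure α}
    [IsProbabilityMeasure μ] {f : α → ℝ} (hf : AEStronglyMeasurable f μ) (hr : 1 ≤ r) :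
    ‖∫ x, f x ∂μ‖ₑ ^ r ≤ ∫⁻ x, ‖f x‖ₑ ^ r ∂μ := by
  have hr0 : 0 < r := by linarith
  calc ‖∫ x, f x ∂μ‖ₑ ^ r
    _ ≤ eLpNorm f (ENNReal.ofReal r) μ ^ r := by
      refine ENNReal.rpow_le_rpow ((enorm_integral_le_lintegral_enorm _).trans ?_) hr0.le
      rw [← eLpNorm_one_eq_lintegral_enorm]
      exact eLpNorm_le_eLpNorm_of_exponent_le (by simpa using hr) hf
    _ = ∫⁻ x, ‖f x‖ₑ ^ r ∂μ := by
      rw [eLpNorm_eq_lintegral_rpow_enorm_toReal (by simpa using hr0) ENNReal.ofReal_ne_top,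
        ENNReal.toReal_ofReal hr0.le, ← ENNReal.rpow_mul, one_div_mul_cancel hr0.ne',
        ENNReal.rpow_one]

theorem lintegral_enorm_sub_mean_rpow_le [IsProbabilityMeasure μ] (hr : 1 ≤ r)
    (hμ : Integrable id μ) :
    ∫⁻ x, ‖x - ∫ y, y ∂μ‖ₑ ^ r ∂μ ≤ absMoment r (symmetrization μ) := by
  rw [absMoment_symmetrization]
  gcongr with x
  have h_mean : x - ∫ y, y ∂μ = ∫ y, (x - y) ∂μ := by
    simp [integral_sub (integrable_const x) (show Integrable (fun y : ℝ => y) μ from hμ)]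
  rw [h_mean]
  exact enorm_integral_rpow_le (by fun_prop) hr

end Moments

/-! ### Convolution semigroups -/

theorem le_mul_of_superadditive {f : ℝ≥0 → ℝ≥0∞} (hf : ∀ s t, f s + f t ≤ f (s + t)) {M t : ℝ≥0}
    (hM : f M ≠ ∞) (ht : t ≤ M) : f t ≤ (2 * t / M : ℝ≥0) * f M := by
  have h_mono : Monotone f := fun s t hst => by
    simpa only [add_tsub_cancel_of_le hst] using le_self_add.trans (hf s (t - s))
  have h_nsmul (n : ℕ) : n * f t ≤ f (n * t) := by
    induction n with
    | zero => simp
    | succ n ih =>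
      push_cast
      rw [add_mul, one_mul, add_mul, one_mul]
      exact (add_le_add_left ih _).trans (hf _ _)
  rcases eq_zero_or_pos t with rfl | ht0
  · have h_zero : f 0 + f 0 ≤ f 0 + 0 := by simpa using hf 0 0
    simpa using (ENNReal.add_le_add_iff_left ((h_mono ht).trans_lt hM.lt_top).ne).1 h_zero
  have hM0 : 0 < M := ht0.trans_le ht
  set N := ⌊M / t⌋₊
  have hN_le : N * t ≤ M := (le_div_iff₀ ht0).1 (Nat.floor_le zero_le)
  have h_one_le : 1 ≤ (2 * t / M) * N := by
    have hN : (1 : ℝ≥0) ≤ N := by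
      exact_mod_cast Nat.le_floor (by simpa using (one_le_div ht0).2 ht)
    have h_lt : M < (N + 1) * t := (div_lt_iff₀ ht0).1 (Nat.lt_floor_add_one _)
    rw [div_mul_eq_mul_div, one_le_div hM0]
    calc M ≤ (N + 1) * t := h_lt.le
      _ ≤ (N + N) * t := by gcongr
      _ = 2 * t * N := by ring
  calc f t ≤ ((2 * t / M) * N : ℝ≥0) * f t := le_mul_of_one_le_left' (by exact_mod_cast h_one_le)
    _ = (2 * t / M : ℝ≥0) * (N * f t) := by push_cast; rw [mul_assoc]
    _ ≤ (2 * t / M : ℝ≥0) * f M := by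
      gcongr
      exact (h_nsmul N).trans (h_mono hN_le)

-- The hom extends to the odd function `t ↦ f t⁺ - f t⁻` on the line.
theorem eq_mul_of_measurable_addMonoidHom (f : ℝ≥0 →+ ℝ) (hf : Measurable f) (t : ℝ≥0) :
    f t = t * f 1 := by
  let F : ℝ →+ ℝ := AddMonoidHom.mk' (fun t => f t.toNNReal - f (-t).toNNReal) fun s t => by
    have h_parts : (s + t).toNNReal + ((-s).toNNReal + (-t).toNNReal) =
        (-(s + t)).toNNReal + (s.toNNReal + t.toNNReal) := by
      ext
      push_cast [Real.coe_toNNReal']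
      have (x : ℝ) : max x 0 = max (-x) 0 + x := by
        rcases le_total x 0 with h | h <;> simp [h]
      linarith [this s, this t, this (s + t)]
    have h_map := congrArg f h_parts
    simp only [map_add] at h_map
    linarith
  have hF : Continuous F := Measure.AddMonoidHom.continuous_of_measurable F (by
    change Measurable fun t : ℝ => f t.toNNReal - f (-t).toNNReal
    fun_prop)
  simpa [F, Real.toNNReal_of_nonpos (neg_nonpos.2 t.2), Real.toNNReal_of_nonpos] using
    map_real_smul F hF t 1

theorem tendsto_mul_im_charFun {μ : Measure ℝ} [IsProbabilityMeasure μ] (hμ : Integrable id μ) :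
    Tendsto (fun z : ℝ => z⁻¹ * (charFun μ z).im) (𝓝[≠] 0) (𝓝 (∫ x, x ∂μ)) := by
  have h_memLp : MemLp id (1 : ℕ) μ := by simpa using memLp_one_iff_integrable.2 hμ
  have h_deriv : HasDerivAt (charFun μ) (Complex.I * (∫ x, x ∂μ : ℝ)) 0 := by
    have h_diff := ((contDiff_charFun h_memLp).differentiable (by simp) 0).hasDerivAt
    rwa [← iteratedDeriv_one, iteratedDeriv_charFun_zero h_memLp, pow_one,
      integral_congr_ae (ae_of_all μ fun x => pow_one x)] at h_diff
  have h_slope := (Complex.continuous_im.tendsto _).comp h_deriv.tendsto_slope_zero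
  simpa [Function.comp_def] using h_slope

/-- The laws `μ t` form the convolution semigroup of infinitely divisible laws with characteristic
exponent `ψ`. -/
structure IsConvSemigroup (ψ : ℝ → ℂ) (μ : ℝ≥0 → Measure ℝ) : Prop where
  isProbabilityMeasure : ∀ t, IsProbabilityMeasure (μ t)
  charFun_eq : ∀ t z, charFun (μ t) z = Complex.exp ((t : ℝ) * ψ z)

namespace IsConvSemigroup

variable {ψ : ℝ → ℂ} {μ : ℝ≥0 → Measure ℝ} {r : ℝ}

theorem conv (h : IsConvSemigroup ψ μ) (s t : ℝ≥0) : μ s ∗ μ t = μ (s + t) := by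
  have := h.isProbabilityMeasure
  refine Measure.ext_of_charFun (funext fun z => ?_)
  rw [charFun_conv, h.charFun_eq, h.charFun_eq, h.charFun_eq, ← Complex.exp_add]
  push_cast
  ring_nf

theorem absMoment_natCast_lt_top (h : IsConvSemigroup ψ μ) (hr : 1 ≤ r)
    (h1 : absMoment r (μ 1) < ∞) (n : ℕ) : absMoment r (μ (n + 1)) < ∞ := by
  have := h.isProbabilityMeasure
  induction n with
  | zero => simpa using h1
  | succ n ih =>
    push_cast
    rw [← h.conv]
    exact absMoment_conv_lt_top hr ih h1

theorem exists_absMoment_symmetrization_le (h : IsConvSemigroup ψ μ) (hr : 2 ≤ r)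
    (h1 : absMoment r (μ 1) < ∞) (V : ℝ≥0) :
    ∃ C : ℝ≥0, ∀ t ≤ V, absMoment r (symmetrization (μ t)) ≤ C * t := by
  have := h.isProbabilityMeasure
  obtain ⟨n, hn⟩ := exists_nat_ge V
  have h_fin : absMoment r (symmetrization (μ (n + 1))) < ∞ :=
    absMoment_symmetrization_lt_top (by linarith)
      (h.absMoment_natCast_lt_top (by linarith) h1 n)
  have h_superadd (s t : ℝ≥0) : absMoment r (symmetrization (μ s)) +
      absMoment r (symmetrization (μ t)) ≤ absMoment r (symmetrization (μ (s + t))) := by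
    rw [← h.conv, symmetrization_conv]
    exact absMoment_add_le_absMoment_conv hr
  refine ⟨2 / (n + 1) * (absMoment r (symmetrization (μ (n + 1)))).toNNReal, fun t ht => ?_⟩
  refine (le_mul_of_superadditive h_superadd h_fin.ne
    (ht.trans (hn.trans le_self_add))).trans_eq ?_
  rw [ENNReal.coe_mul, ENNReal.coe_toNNReal h_fin.ne, mul_right_comm, ← ENNReal.coe_mul,
    div_mul_eq_mul_div]

theorem memLp_id (h : IsConvSemigroup ψ μ) (hr : 2 ≤ r) (h1 : MemLp id (ENNReal.ofReal r) (μ 1))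
    (t : ℝ≥0) : MemLp id (ENNReal.ofReal r) (μ t) := by
  have := h.isProbabilityMeasure
  have hr0 : 0 < r := by linarith
  obtain ⟨C, hC⟩ := h.exists_absMoment_symmetrization_le hr
    ((memLp_ofReal_iff aestronglyMeasurable_id hr0).1 h1) t
  exact memLp_id_of_absMoment_symmetrization_lt_top hr0
    ((hC t le_rfl).trans_lt (by exact_mod_cast ENNReal.coe_lt_top))

theorem exists_lintegral_enorm_sub_mean_rpow_le (h : IsConvSemigroup ψ μ) (hr : 2 ≤ r)
    (h1 : MemLp id (ENNReal.ofReal r) (μ 1)) (V : ℝ≥0) :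
    ∃ C : ℝ≥0, ∀ t ≤ V, ∫⁻ x, ‖x - ∫ y, y ∂(μ t)‖ₑ ^ r ∂(μ t) ≤ C * t := by
  have := h.isProbabilityMeasure
  obtain ⟨C, hC⟩ := h.exists_absMoment_symmetrization_le hr
    ((memLp_ofReal_iff aestronglyMeasurable_id (by linarith)).1 h1) V
  refine ⟨C, fun t ht => (lintegral_enorm_sub_mean_rpow_le (by linarith) ?_).trans (hC t ht)⟩
  exact (h.memLp_id hr h1 t).integrable (ENNReal.one_le_ofReal.2 (by linarith))

theorem mean_add (h : IsConvSemigroup ψ μ) (hμ : ∀ t, Integrable id (μ t)) (s t : ℝ≥0) :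
    ∫ x, x ∂(μ (s + t)) = ∫ x, x ∂(μ s) + ∫ x, x ∂(μ t) := by
  have := h.isProbabilityMeasure
  rw [← h.conv, Measure.conv, integral_map (by fun_prop) (by fun_prop),
    integral_add (f := fun x : ℝ × ℝ => x.1) (g := fun x : ℝ × ℝ => x.2) ((hμ s).comp_fst _)
      ((hμ t).comp_snd _)]
  simp only [integral_fun_fst fun x : ℝ => x, integral_fun_snd fun x : ℝ => x, probReal_univ,
    one_smul]

theorem variance_add (h : IsConvSemigroup ψ μ) (hμ : ∀ t, MemLp id 2 (μ t)) (s t : ℝ≥0) :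
    variance id (μ (s + t)) = variance id (μ s) + variance id (μ t) := by
  have := h.isProbabilityMeasure
  have h_indep := (indepFun_prod (μ := μ s) (ν := μ t) measurable_id measurable_id).variance_add
    ((hμ s).comp_fst _) ((hμ t).comp_snd _)
  rw [← h.conv, Measure.conv, variance_id_map (by fun_prop)]
  refine h_indep.trans (congrArg₂ (· + ·) ?_ ?_)
  · exact (measurePreserving_fst (μ := μ s) (ν := μ t)).variance_fun_comp aemeasurable_id
  · exact (measurePreserving_snd (μ := μ s) (ν := μ t)).variance_fun_comp aemeasurable_id

theorem variance_eq (h : IsConvSemigroup ψ μ) (hμ : ∀ t, MemLp id 2 (μ t)) (t : ℝ≥0) :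
    variance id (μ t) = t * variance id (μ 1) := by
  have h_mono : Monotone fun t => variance id (μ t) := fun s t hst => by
    obtain ⟨u, rfl⟩ := exists_add_of_le hst
    simp only [h.variance_add hμ, le_add_iff_nonneg_right, variance_nonneg]
  have h_zero : variance id (μ 0) = 0 := by simpa using h.variance_add hμ 0 0
  exact eq_mul_of_measurable_addMonoidHom
    { toFun := fun t => variance id (μ t), map_zero' := h_zero, map_add' := h.variance_add hμ }
    h_mono.measurable t

theorem mean_eq (h : IsConvSemigroup ψ μ) (hμ : ∀ t, Integrable id (μ t)) (t : ℝ≥0) :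
    ∫ x, x ∂(μ t) = t * ∫ x, x ∂(μ 1) := by
  have := h.isProbabilityMeasure
  -- The mean is a pointwise limit of functions that are continuous in `t`.
  have h_meas : Measurable fun t => ∫ x, x ∂(μ t) := by
    refine measurable_of_tendsto_metrizable' (𝓝[≠] (0 : ℝ))
      (f := fun z t => z⁻¹ * (charFun (μ t) z).im) (fun z => ?_)
      (tendsto_pi_nhds.2 fun t => tendsto_mul_im_charFun (hμ t))
    simp only [h.charFun_eq]
    fun_prop
  have h_zero : ∫ x, x ∂(μ 0) = 0 := by simpa using h.mean_add hμ 0 0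
  exact eq_mul_of_measurable_addMonoidHom
    { toFun := fun t => ∫ x, x ∂(μ t), map_zero' := h_zero, map_add' := h.mean_add hμ }
    h_meas t

end IsConvSemigroup

/-! ### Lévy bases -/

section LevyBasis

variable {Ω : Type*} [MeasurableSpace Ω] {P : Measure Ω}
  {γ b : ℝ} {ν seed : Measure ℝ} {L : Set (ℝ × ℝ) → Ω → ℝ} {B C : Set (ℝ × ℝ)}

/-- The law of the value of `L` at a set of measure `t`, read off the strip `(0, t] × (0, 1]`. -/
noncomputable def marginalLaw (P : Measure Ω) (L : Set (ℝ × ℝ) → Ω → ℝ) (t : ℝ≥0) : Measure ℝ :=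
  P.map (L (Ioc 0 (t : ℝ) ×ˢ Ioc 0 1))

/-- The centred basis `L(B) - m Leb(B)`. -/
noncomputable def centered (L : Set (ℝ × ℝ) → Ω → ℝ) (m : ℝ) (B : Set (ℝ × ℝ)) (ω : Ω) : ℝ :=
  L B ω - m * volume.real B

/-- The field `L(B) - m Leb(B)` is centred with variance `Leb(B)`, and its `R`-th moments are of the
order of `Leb(B)` on sets of bounded measure. -/
structure HasMoments (P : Measure Ω) (L : Set (ℝ × ℝ) → Ω → ℝ) (m R : ℝ) : Prop where
  memLp : ∀ B, MeasurableSet B → Bornology.IsBounded B →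
    MemLp (centered L m B) (ENNReal.ofReal R) P
  mean : ∀ B, MeasurableSet B → Bornology.IsBounded B → ∫ ω, centered L m B ω ∂P = 0
  sq : ∀ B, MeasurableSet B → Bornology.IsBounded B →
    ∫ ω, centered L m B ω ^ 2 ∂P = volume.real B
  moment_le : ∀ V, ∃ C, 0 ≤ C ∧ ∀ B, MeasurableSet B → Bornology.IsBounded B →
    volume.real B ≤ V → ∫ ω, |centered L m B ω| ^ R ∂P ≤ C * volume.real B

namespace IsLevyBasis

theorem measurable_centered (hL : IsLevyBasis P γ b ν L) (m : ℝ) (hB : MeasurableSet B)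
    (hB_bdd : Bornology.IsBounded B) : Measurable (centered L m B) :=
  (hL.measurable B hB hB_bdd).sub_const _

section Moments

variable [IsProbabilityMeasure P] {R r : ℝ}

theorem isConvSemigroup (hL : IsLevyBasis P γ b ν L) :
    IsConvSemigroup (charExponent γ b ν) (marginalLaw P L) := by
  have h_meas (t : ℝ≥0) : MeasurableSet (Ioc 0 (t : ℝ) ×ˢ Ioc (0 : ℝ) 1) :=
    measurableSet_Ioc.prod measurableSet_Ioc
  have h_bdd (t : ℝ≥0) : Bornology.IsBounded (Ioc 0 (t : ℝ) ×ˢ Ioc (0 : ℝ) 1) :=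
    (Metric.isBounded_Ioc 0 _).prod (Metric.isBounded_Ioc 0 1)
  refine ⟨fun t => Measure.isProbabilityMeasure_map
    (hL.measurable _ (h_meas t) (h_bdd t)).aemeasurable, fun t z => ?_⟩
  rw [marginalLaw, hL.charFun_eq _ (h_meas t) (h_bdd t), Measure.volume_eq_prod,
    Measure.prod_prod]
  simp

theorem map_eq (hL : IsLevyBasis P γ b ν L) (hB : MeasurableSet B)
    (hB_bdd : Bornology.IsBounded B) : P.map (L B) = marginalLaw P L (volume B).toNNReal := by
  have := hL.isConvSemigroup.isProbabilityMeasure (volume B).toNNReal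
  have : IsProbabilityMeasure (P.map (L B)) :=
    Measure.isProbabilityMeasure_map (hL.measurable B hB hB_bdd).aemeasurable
  refine Measure.ext_of_charFun (funext fun z => ?_)
  rw [hL.charFun_eq B hB hB_bdd, hL.isConvSemigroup.charFun_eq]
  rfl

theorem marginalLaw_one (hL : IsLevyBasis P γ b ν L) (hseed : IsSeedLaw γ b ν seed) :
    marginalLaw P L 1 = seed := by
  have := hL.isConvSemigroup.isProbabilityMeasure 1
  have := hseed.1
  refine Measure.ext_of_charFun (funext fun z => ?_)
  rw [hseed.2, hL.isConvSemigroup.charFun_eq]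
  simp

theorem memLp_marginalLaw (hL : IsLevyBasis P γ b ν L) (hseed : IsSeedLaw γ b ν seed) (hr : 2 ≤ r)
    (hmom : MemLp id (ENNReal.ofReal r) seed) (t : ℝ≥0) :
    MemLp id (ENNReal.ofReal r) (marginalLaw P L t) :=
  hL.isConvSemigroup.memLp_id hr (by rwa [hL.marginalLaw_one hseed]) t

theorem memLp (hL : IsLevyBasis P γ b ν L) (hseed : IsSeedLaw γ b ν seed) (hr : 2 ≤ r)
    (hmom : MemLp id (ENNReal.ofReal r) seed) (hB : MeasurableSet B)
    (hB_bdd : Bornology.IsBounded B) : MemLp (L B) (ENNReal.ofReal r) P := by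
  refine (memLp_map_measure_iff aestronglyMeasurable_id
    (hL.measurable B hB hB_bdd).aemeasurable).1 ?_
  rw [hL.map_eq hB hB_bdd]
  exact hL.memLp_marginalLaw hseed hr hmom _

theorem mean_marginalLaw (hL : IsLevyBasis P γ b ν L) (hseed : IsSeedLaw γ b ν seed)
    (hmom : MemLp id 2 seed) (t : ℝ≥0) :
    ∫ x, x ∂(marginalLaw P L t) = t * ∫ x, x ∂seed := by
  have := hL.isConvSemigroup.isProbabilityMeasure
  rw [hL.isConvSemigroup.mean_eq (fun t => ?_), hL.marginalLaw_one hseed]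
  exact (hL.memLp_marginalLaw hseed le_rfl (by simpa using hmom) t).integrable (by norm_num)

theorem integral_centered (hL : IsLevyBasis P γ b ν L) (hseed : IsSeedLaw γ b ν seed)
    (hmom : MemLp id 2 seed) (hB : MeasurableSet B) (hB_bdd : Bornology.IsBounded B) :
    ∫ ω, centered L (∫ x, x ∂seed) B ω ∂P = 0 := by
  have h_int : Integrable (L B) P :=
    (hL.memLp hseed le_rfl (by simpa using hmom) hB hB_bdd).integrable (by norm_num)
  have h_mean : ∫ ω, L B ω ∂P = ∫ x, x ∂(P.map (L B)) :=
    (integral_map (hL.measurable B hB hB_bdd).aemeasurable aestronglyMeasurable_id).symm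
  simp only [centered]
  rw [integral_sub h_int (integrable_const _), h_mean, hL.map_eq hB hB_bdd,
    hL.mean_marginalLaw hseed hmom, integral_const, probReal_univ, one_smul, mul_comm]
  exact sub_self _

theorem integral_centered_sq (hL : IsLevyBasis P γ b ν L) (hseed : IsSeedLaw γ b ν seed)
    (hmom : MemLp id 2 seed) (hB : MeasurableSet B) (hB_bdd : Bornology.IsBounded B) :
    ∫ ω, centered L (∫ x, x ∂seed) B ω ^ 2 ∂P = volume.real B * variance id seed := by
  have h_var := hL.isConvSemigroup.variance_eq
    (fun t => by simpa using hL.memLp_marginalLaw hseed le_rfl (by simpa using hmom) t)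
    (volume B).toNNReal
  rw [variance_eq_integral aemeasurable_id, hL.marginalLaw_one hseed] at h_var
  simp only [id] at h_var
  rwa [hL.mean_marginalLaw hseed hmom, ← hL.map_eq hB hB_bdd,
    integral_map (hL.measurable B hB hB_bdd).aemeasurable (by fun_prop), mul_comm _ (∫ x, x ∂seed)]
    at h_var

theorem exists_lintegral_centered_rpow_le (hL : IsLevyBasis P γ b ν L)
    (hseed : IsSeedLaw γ b ν seed) (hr : 2 ≤ r) (hmom : MemLp id (ENNReal.ofReal r) seed)
    (V : ℝ≥0) : ∃ C : ℝ≥0, ∀ B, MeasurableSet B → Bornology.IsBounded B →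
      (volume B).toNNReal ≤ V →
        ∫⁻ ω, ‖centered L (∫ x, x ∂seed) B ω‖ₑ ^ r ∂P ≤ C * (volume B).toNNReal := by
  have := hseed.1
  obtain ⟨C, hC⟩ := hL.isConvSemigroup.exists_lintegral_enorm_sub_mean_rpow_le hr
    (by rwa [hL.marginalLaw_one hseed]) V
  refine ⟨C, fun B hB hB_bdd hBV => le_of_eq_of_le ?_ (hC _ hBV)⟩
  have hmom_two : MemLp id 2 seed :=
    hmom.mono_exponent (by simpa using ENNReal.ofReal_le_ofReal hr)
  rw [hL.mean_marginalLaw hseed hmom_two, ← hL.map_eq hB hB_bdd,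
    lintegral_map (by fun_prop) (hL.measurable B hB hB_bdd), mul_comm _ (∫ x, x ∂seed)]
  rfl

theorem exists_integral_centered_rpow_le (hL : IsLevyBasis P γ b ν L)
    (hseed : IsSeedLaw γ b ν seed) (hr : 2 ≤ r) (hmom : MemLp id (ENNReal.ofReal r) seed)
    (V : ℝ) : ∃ C, 0 ≤ C ∧ ∀ B, MeasurableSet B → Bornology.IsBounded B → volume.real B ≤ V →
      ∫ ω, |centered L (∫ x, x ∂seed) B ω| ^ r ∂P ≤ C * volume.real B := by
  obtain ⟨C, hC⟩ := hL.exists_lintegral_centered_rpow_le hseed hr hmom V.toNNReal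
  refine ⟨C, C.2, fun B hB hB_bdd hBV => ?_⟩
  have h_meas := hL.measurable_centered (∫ x, x ∂seed) hB hB_bdd
  rw [integral_eq_lintegral_of_nonneg_ae (ae_of_all _ fun ω => by positivity)
    (by fun_prop : Measurable fun ω => |centered L _ B ω| ^ r).aestronglyMeasurable]
  refine ENNReal.toReal_le_of_le_ofReal (by positivity) ?_
  simp only [← ENNReal.ofReal_rpow_of_nonneg (abs_nonneg _) (by linarith : 0 ≤ r),
    ← Real.enorm_eq_ofReal_abs]
  refine (hC B hB hB_bdd (NNReal.le_toNNReal_of_coe_le hBV)).trans_eq ?_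
  rw [ENNReal.ofReal_mul C.coe_nonneg, measureReal_def,
    ENNReal.ofReal_toReal hB_bdd.measure_lt_top.ne,
    ENNReal.coe_toNNReal hB_bdd.measure_lt_top.ne, ENNReal.ofReal_coe_nnreal]

theorem hasMoments (hL : IsLevyBasis P γ b ν L) (hseed : IsSeedLaw γ b ν seed)
    (hvar : variance id seed = 1) (hR : 2 ≤ R) (hmom : MemLp id (ENNReal.ofReal R) seed) :
    HasMoments P L (∫ x, x ∂seed) R := by
  have := hseed.1
  have hmom_two : MemLp id 2 seed := by
    simpa using hmom.mono_exponent (ENNReal.ofReal_le_ofReal hR)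
  exact
    { memLp B hB hB_bdd := (hL.memLp hseed hR hmom hB hB_bdd).sub (memLp_const _)
      mean B hB hB_bdd := hL.integral_centered hseed hmom_two hB hB_bdd
      sq B hB hB_bdd := by
        rw [hL.integral_centered_sq hseed hmom_two hB hB_bdd, hvar, mul_one]
      moment_le := hL.exists_integral_centered_rpow_le hseed hR hmom }

end Moments

theorem empty_ae_eq (hL : IsLevyBasis P γ b ν L) : L ∅ =ᵐ[P] 0 := by
  have h_additive := hL.additive (fun _ => ∅) (fun _ => MeasurableSet.empty) (by simp)
    (fun i j _ => disjoint_bot_left)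
  filter_upwards [h_additive] with ω hω
  have h_diff := (hω.comp (tendsto_add_atTop_nat 1)).sub hω
  simp only [Function.comp_apply, Finset.sum_range_succ, add_sub_cancel_left, sub_self] at h_diff
  exact tendsto_nhds_unique tendsto_const_nhds h_diff

theorem union_ae_eq (hL : IsLevyBasis P γ b ν L) (hB : MeasurableSet B) (hC : MeasurableSet C)
    (hB_bdd : Bornology.IsBounded B) (hC_bdd : Bornology.IsBounded C) (hBC : Disjoint B C) :
    L (B ∪ C) =ᵐ[P] fun ω => L B ω + L C ω := by
  let D : ℕ → Set (ℝ × ℝ)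
    | 0 => B
    | 1 => C
    | _ + 2 => ∅
  have hD_union : ⋃ i, D i = B ∪ C := by
    rw [← union_iUnion_nat_succ, ← union_iUnion_nat_succ]
    simp [D]
  have h_additive := hL.additive D (fun | 0 => hB | 1 => hC | _ + 2 => .empty)
    (by rw [hD_union]; exact hB_bdd.union hC_bdd)
    ((pairwise_disjoint_on D).2 fun
      | 0, 1, _ => hBC
      | 0, _ + 2, _ => disjoint_bot_right
      | 1, _ + 2, _ => disjoint_bot_right
      | _ + 2, _, _ => disjoint_bot_left)
  filter_upwards [h_additive, hL.empty_ae_eq] with ω hω h_empty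
  rw [hD_union] at hω
  refine tendsto_nhds_unique (hω.comp (tendsto_add_atTop_nat 2))
    (tendsto_const_nhds.congr fun n => ?_)
  simp [Finset.sum_range_succ', D, h_empty, add_comm]

theorem centered_biUnion_ae_eq (hL : IsLevyBasis P γ b ν L) (m : ℝ) {ι : Type*}
    {C : ι → Set (ℝ × ℝ)} (hC : ∀ i, MeasurableSet (C i))
    (hC_bdd : ∀ i, Bornology.IsBounded (C i)) (hC_disj : Pairwise fun i j => Disjoint (C i) (C j))
    (S : Finset ι) : centered L m (⋃ i ∈ S, C i) =ᵐ[P] fun ω => ∑ i ∈ S, centered L m (C i) ω := by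
  classical
  induction S using Finset.induction_on with
  | empty =>
    filter_upwards [hL.empty_ae_eq] with ω h_empty
    simp [centered, h_empty]
  | insert i S hi ih =>
    have hS : MeasurableSet (⋃ j ∈ S, C j) := S.measurableSet_biUnion fun j _ => hC j
    have hS_bdd : Bornology.IsBounded (⋃ j ∈ S, C j) :=
      (Bornology.isBounded_biUnion_finset S).2 fun j _ => hC_bdd j
    have h_disj : Disjoint (C i) (⋃ j ∈ S, C j) :=
      disjoint_iUnion₂_right.2 fun j hj => hC_disj fun hij => hi (hij ▸ hj)
    filter_upwards [ih, hL.union_ae_eq (hC i) hS (hC_bdd i) hS_bdd h_disj] with ω h_sum h_union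
    rw [Finset.set_biUnion_insert, Finset.sum_insert hi, ← h_sum]
    simp only [centered]
    rw [h_union, measureReal_union h_disj hS (hC_bdd i).measure_lt_top.ne
      hS_bdd.measure_lt_top.ne]
    ring

theorem iIndepFun_centered (hL : IsLevyBasis P γ b ν L) (m : ℝ) {ι : Type*} [Countable ι]
    {C : ι → Set (ℝ × ℝ)} (hC : ∀ i, MeasurableSet (C i))
    (hC_bdd : ∀ i, Bornology.IsBounded (C i))
    (hC_disj : Pairwise fun i j => Disjoint (C i) (C j)) :
    iIndepFun (fun i => centered L m (C i)) P := by
  have := Encodable.ofCountable ι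
  have h_indep := (hL.indep (fun n => ⋃ i ∈ Encodable.decode₂ ι n, C i)
    (fun _ => Encodable.iUnion_decode₂_cases .empty hC)
    (fun _ => Encodable.iUnion_decode₂_cases Bornology.isBounded_empty hC_bdd)
    (Encodable.iUnion_decode₂_disjoint_on hC_disj)).precomp (Encodable.encode_injective (α := ι))
  simp only [Encodable.decode₂_encode, Option.mem_some_iff, iUnion_iUnion_eq_right] at h_indep
  exact h_indep.comp (fun i x => x - m * volume.real (C i)) fun i => by fun_prop

end IsLevyBasis

end LevyBasis

/-! ### Absolute moments of random variables -/

section Moments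

variable {Ω : Type*} [MeasurableSpace Ω] {P : Measure Ω} {p A B : ℝ} {f g : Ω → ℝ}

theorem memLp_iff_integrable_abs_rpow (hf : AEStronglyMeasurable f P) (hp : 0 < p) :
    MemLp f (ENNReal.ofReal p) P ↔ Integrable (fun ω => |f ω| ^ p) P := by
  have h := integrable_norm_rpow_iff hf (p := ENNReal.ofReal p) (by simpa using hp)
    ENNReal.ofReal_ne_top
  rw [ENNReal.toReal_ofReal hp.le] at h
  exact h.symm

theorem integrable_abs_rpow_of_memLp (hp : 0 < p)
    (hf : MemLp f (ENNReal.ofReal p) P) : Integrable (fun ω => |f ω| ^ p) P :=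
  (memLp_iff_integrable_abs_rpow hf.1 hp).1 hf

theorem memLp_two_of_le [IsFiniteMeasure P] (hp : 2 ≤ p)
    (hf : MemLp f (ENNReal.ofReal p) P) : MemLp f 2 P := by
  refine hf.mono_exponent ?_
  rw [← ENNReal.ofReal_ofNat]
  exact ENNReal.ofReal_le_ofReal hp

/-- The `p`-th absolute moment of `f` is finite and at most `B`. -/
structure HasMomentLE (P : Measure Ω) (p B : ℝ) (f : Ω → ℝ) : Prop where
  memLp : MemLp f (ENNReal.ofReal p) P
  integral_le : ∫ ω, |f ω| ^ p ∂P ≤ B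

theorem abs_mul_rpow_le (x y r : ℝ) : |x * y| ^ r ≤ (|x| ^ (2 * r) + |y| ^ (2 * r)) / 2 := by
  have hsq (u : ℝ) : |u| ^ (2 * r) = (|u| ^ r) ^ 2 := by
    rw [mul_comm, Real.rpow_mul (abs_nonneg u), Real.rpow_two]
  rw [abs_mul, Real.mul_rpow (abs_nonneg _) (abs_nonneg _), hsq, hsq]
  linarith [two_mul_le_add_sq (|x| ^ r) (|y| ^ r)]

namespace HasMomentLE

theorem nonneg (hf : HasMomentLE P p B f) : 0 ≤ B :=
  (integral_nonneg fun _ => by positivity).trans hf.integral_le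

theorem mono (hf : HasMomentLE P p A f) (hAB : A ≤ B) : HasMomentLE P p B f :=
  ⟨hf.memLp, hf.integral_le.trans hAB⟩

theorem congr_ae (hf : HasMomentLE P p B f) (hfg : f =ᵐ[P] g) : HasMomentLE P p B g where
  memLp := hf.memLp.ae_eq hfg
  integral_le := by
    refine (integral_congr_ae ?_).symm.trans_le hf.integral_le
    filter_upwards [hfg] with ω hω
    rw [hω]

theorem const_mul (hf : HasMomentLE P p B f) (c : ℝ) :
    HasMomentLE P p (|c| ^ p * B) fun ω => c * f ω where
  memLp := hf.memLp.const_mul c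
  integral_le := by
    simp_rw [abs_mul, Real.mul_rpow (abs_nonneg _) (abs_nonneg _), integral_const_mul]
    gcongr
    exact hf.integral_le

theorem sum (hp : 1 ≤ p) {ι : Type*} {s : Finset ι} {F : ι → Ω → ℝ}
    (hF : ∀ i ∈ s, HasMomentLE P p B (F i)) :
    HasMomentLE P p ((s.card : ℝ) ^ p * B) fun ω => ∑ i ∈ s, F i ω where
  memLp := memLp_finsetSum s fun i hi => (hF i hi).memLp
  integral_le := by
    have hp0 : 0 < p := by linarith
    have hF_int (i) (hi : i ∈ s) := integrable_abs_rpow_of_memLp hp0 (hF i hi).memLp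
    have hpower_mean (ω : Ω) :
        |∑ i ∈ s, F i ω| ^ p ≤ (s.card : ℝ) ^ (p - 1) * ∑ i ∈ s, |F i ω| ^ p :=
      (Real.rpow_le_rpow (abs_nonneg _) (Finset.abs_sum_le_sum_abs _ _) hp0.le).trans
        (Real.rpow_sum_le_const_mul_sum_rpow s (fun i => F i ω) hp)
    calc ∫ ω, |∑ i ∈ s, F i ω| ^ p ∂P
        ≤ ∫ ω, (s.card : ℝ) ^ (p - 1) * ∑ i ∈ s, |F i ω| ^ p ∂P :=
          integral_mono (integrable_abs_rpow_of_memLp hp0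
            (memLp_finsetSum s fun i hi => (hF i hi).memLp))
            ((integrable_finsetSum s hF_int).const_mul _) hpower_mean
      _ = (s.card : ℝ) ^ (p - 1) * ∑ i ∈ s, ∫ ω, |F i ω| ^ p ∂P := by
          rw [integral_const_mul, integral_finsetSum s hF_int]
      _ ≤ (s.card : ℝ) ^ (p - 1) * (s.card * B) := by
          gcongr
          rw [← nsmul_eq_mul]
          exact Finset.sum_le_card_nsmul s _ B fun i hi => (hF i hi).integral_le
      _ = (s.card : ℝ) ^ p * B := by
          rw [← mul_assoc, ← Real.rpow_add_one' (by positivity) (by linarith), sub_add_cancel]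

theorem neg (hf : HasMomentLE P p B f) : HasMomentLE P p B fun ω => -f ω := by
  simpa using hf.const_mul (-1)

theorem sub (hp : 1 ≤ p) (hf : HasMomentLE P p B f) (hg : HasMomentLE P p B g) :
    HasMomentLE P p (2 ^ p * B) fun ω => f ω - g ω := by
  have hsum := sum hp (s := Finset.univ) (F := ![f, fun ω => -g ω])
    (by simpa [Fin.forall_fin_two] using ⟨hf, hg.neg⟩)
  simpa [Fin.sum_univ_two, ← sub_eq_add_neg] using hsum

theorem sub_four (hp : 1 ≤ p) {f₁ f₂ f₃ f₄ : Ω → ℝ} (hf : HasMomentLE P p B f)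
    (hf₁ : HasMomentLE P p B f₁) (hf₂ : HasMomentLE P p B f₂) (hf₃ : HasMomentLE P p B f₃)
    (hf₄ : HasMomentLE P p B f₄) :
    HasMomentLE P p (5 ^ p * B) fun ω => f ω - f₁ ω - f₂ ω - f₃ ω - f₄ ω := by
  have hsum := sum hp (s := Finset.univ) (B := B) (P := P)
    (F := ![f, fun ω => -f₁ ω, fun ω => -f₂ ω, fun ω => -f₃ ω, fun ω => -f₄ ω]) fun i _ => by
      fin_cases i
      exacts [hf, hf₁.neg, hf₂.neg, hf₃.neg, hf₄.neg]
  simpa [Fin.sum_univ_five, ← sub_eq_add_neg] using hsum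

theorem const [IsProbabilityMeasure P] (p c : ℝ) : HasMomentLE P p (|c| ^ p) fun _ => c :=
  ⟨memLp_const _, by simp⟩

theorem sub_integral [IsProbabilityMeasure P] (hp : 1 ≤ p) (hf : HasMomentLE P p B f) :
    HasMomentLE P p (2 ^ p * B) fun ω => f ω - ∫ ω', f ω' ∂P := by
  have hp0 : 0 < p := by linarith
  have hf_int : Integrable f P := hf.memLp.integrable (by simpa using hp)
  have habs_int := integrable_abs_rpow_of_memLp hp0 hf.memLp
  have hjensen : |∫ ω, f ω ∂P| ^ p ≤ ∫ ω, |f ω| ^ p ∂P :=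
    (Real.rpow_le_rpow (abs_nonneg _) abs_integral_le_integral_abs hp0.le).trans <|
      (convexOn_rpow hp).map_integral_le (Real.continuous_rpow_const hp0.le).continuousOn
        isClosed_Ici (ae_of_all _ fun ω => abs_nonneg (f ω)) hf_int.abs habs_int
  exact hf.sub hp ((const p _).mono (hjensen.trans hf.integral_le))

theorem average (hp : 1 ≤ p) {n : ℕ} (hn : 0 < n) {F : ℕ → Ω → ℝ}
    (hF : ∀ k < n, HasMomentLE P p B (F k)) :
    HasMomentLE P p B fun ω => 1 / (n : ℝ) * ∑ k ∈ Finset.range n, F k ω := by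
  have hsum := (sum hp fun k hk => hF k (Finset.mem_range.1 hk)).const_mul (1 / (n : ℝ))
  rw [Finset.card_range, ← mul_assoc, abs_of_nonneg (by positivity),
    ← Real.mul_rpow (by positivity) (by positivity), one_div_mul_cancel (by positivity),
    Real.one_rpow, one_mul] at hsum
  exact hsum

theorem mul (hp : 0 < p) (hf : HasMomentLE P (2 * p) A f) (hg : HasMomentLE P (2 * p) B g) :
    HasMomentLE P p ((A + B) / 2) fun ω => f ω * g ω := by
  have hf_int := integrable_abs_rpow_of_memLp (by linarith) hf.memLp
  have hg_int := integrable_abs_rpow_of_memLp (by linarith) hg.memLp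
  have hmeas := hf.memLp.1.mul hg.memLp.1
  have hint : Integrable (fun ω => |f ω * g ω| ^ p) P := by
    refine ((hf_int.add hg_int).div_const 2).mono'
      (hmeas.aemeasurable.abs.pow_const p).aestronglyMeasurable (ae_of_all _ fun ω => ?_)
    rw [Real.norm_of_nonneg (by positivity)]
    exact abs_mul_rpow_le _ _ _
  refine ⟨(memLp_iff_integrable_abs_rpow hmeas hp).2 hint, ?_⟩
  calc ∫ ω, |f ω * g ω| ^ p ∂P ≤ ∫ ω, (|f ω| ^ (2 * p) + |g ω| ^ (2 * p)) / 2 ∂P :=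
        integral_mono hint ((hf_int.add hg_int).div_const 2) fun ω => abs_mul_rpow_le _ _ _
    _ = (∫ ω, |f ω| ^ (2 * p) ∂P + ∫ ω, |g ω| ^ (2 * p) ∂P) / 2 := by
        rw [integral_div, integral_add hf_int hg_int]
    _ ≤ (A + B) / 2 := by linarith [hf.integral_le, hg.integral_le]

theorem eLpNorm_le (hp : 0 < p) (hf : HasMomentLE P p B f) :
    eLpNorm f (ENNReal.ofReal p) P ≤ ENNReal.ofReal (B ^ p⁻¹) := by
  have hp_ne : ENNReal.ofReal p ≠ 0 := (ENNReal.ofReal_pos.2 hp).ne'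
  rw [hf.memLp.eLpNorm_eq_integral_rpow_norm hp_ne ENNReal.ofReal_ne_top,
    ENNReal.toReal_ofReal hp.le]
  exact ENNReal.ofReal_le_ofReal (Real.rpow_le_rpow (integral_nonneg fun ω => by positivity)
    hf.integral_le (by positivity))

theorem of_eLpNorm_le (hp : 0 < p) (hB : 0 ≤ B) (hf : AEStronglyMeasurable f P)
    (hle : eLpNorm f (ENNReal.ofReal p) P ≤ ENNReal.ofReal (B ^ p⁻¹)) : HasMomentLE P p B f := by
  have hf_memLp : MemLp f (ENNReal.ofReal p) P := ⟨hf, hle.trans_lt ENNReal.ofReal_lt_top⟩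
  have hp_ne : ENNReal.ofReal p ≠ 0 := (ENNReal.ofReal_pos.2 hp).ne'
  rw [hf_memLp.eLpNorm_eq_integral_rpow_norm hp_ne ENNReal.ofReal_ne_top,
    ENNReal.toReal_ofReal hp.le, ENNReal.ofReal_le_ofReal_iff (by positivity)] at hle
  exact ⟨hf_memLp, (Real.rpow_le_rpow_iff (integral_nonneg fun ω => by positivity) hB
    (by positivity)).1 hle⟩

theorem of_tendsto_ae (hp : 0 < p) {F : ℕ → Ω → ℝ} (hF : ∀ i, HasMomentLE P p B (F i))
    (hlim : ∀ᵐ ω ∂P, Tendsto (fun i => F i ω) atTop (𝓝 (f ω))) : HasMomentLE P p B f :=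
  of_eLpNorm_le hp (hF 0).nonneg
    (aestronglyMeasurable_of_tendsto_ae atTop (fun i => (hF i).memLp.1) hlim)
    (Lp.eLpNorm_le_of_ae_tendsto (Eventually.of_forall fun i => (hF i).eLpNorm_le hp)
      (fun i => (hF i).memLp.1) hlim)

end HasMomentLE

end Moments

/-! ### A Rosenthal type inequality -/

section Rosenthal

/-- The constant of the second-order Taylor bound `abs_add_rpow_le` for `x ↦ |x| ^ p`. -/
noncomputable def taylorConst (p : ℝ) : ℝ := p ^ 2 + (p + 1) ^ p

variable {p : ℝ}

theorem one_le_taylorConst (hp : 2 ≤ p) : 1 ≤ taylorConst p := by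
  have : 1 ≤ (p + 1) ^ p := Real.one_le_rpow (by linarith) (by linarith)
  exact this.trans (le_add_of_nonneg_left (sq_nonneg p))

theorem abs_one_add_rpow_le_of_small (hp : 2 ≤ p) {u : ℝ} (hu : p * |u| ≤ 1) :
    |1 + u| ^ p ≤ 1 + p * u + p ^ 2 * u ^ 2 := by
  have hpu : |p * u| ≤ 1 := by rwa [abs_mul, abs_of_nonneg (by linarith : 0 ≤ p)]
  have hu1 : 0 ≤ 1 + u := by nlinarith [neg_abs_le u, abs_nonneg u]
  calc |1 + u| ^ p ≤ Real.exp u ^ p := by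
        rw [abs_of_nonneg hu1]
        exact Real.rpow_le_rpow hu1 (by linarith [Real.add_one_le_exp u]) (by linarith)
    _ = Real.exp (p * u) := by rw [← Real.exp_mul, mul_comm]
    _ ≤ 1 + p * u + p ^ 2 * u ^ 2 := by
        linarith [(abs_le.1 (Real.abs_exp_sub_one_sub_id_le hpu)).2, mul_pow p u 2]

theorem abs_one_add_rpow_le_of_large (hp : 2 ≤ p) {u : ℝ} (hu : 1 ≤ p * |u|) :
    |1 + u| ^ p ≤ 1 + p * u + (p ^ 2 * u ^ 2 + (p + 1) ^ p * |u| ^ p) := by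
  have hadd : |1 + u| ≤ (p + 1) * |u| := by
    linarith [abs_add_le 1 u, abs_one (α := ℝ)]
  have hpow : |1 + u| ^ p ≤ (p + 1) ^ p * |u| ^ p := by
    rw [← Real.mul_rpow (by linarith) (abs_nonneg u)]
    exact Real.rpow_le_rpow (abs_nonneg _) hadd (by linarith)
  have hlin : -(p * u) ≤ p ^ 2 * u ^ 2 := by
    rw [← sq_abs u, ← mul_pow]
    nlinarith [neg_abs_le u]
  linarith

theorem abs_one_add_rpow_le (hp : 2 ≤ p) (u : ℝ) :
    |1 + u| ^ p ≤ 1 + p * u + taylorConst p * (u ^ 2 + |u| ^ p) := by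
  have hsq : 0 ≤ (p + 1) ^ p * u ^ 2 := by positivity
  have hpow : 0 ≤ p ^ 2 * |u| ^ p := by positivity
  have hpow' : 0 ≤ (p + 1) ^ p * |u| ^ p := by positivity
  rw [taylorConst]
  rcases le_total (p * |u|) 1 with hu | hu
  · linarith [abs_one_add_rpow_le_of_small hp hu]
  · linarith [abs_one_add_rpow_le_of_large hp hu]

theorem abs_rpow_sub_two_mul_sq (hp : 2 ≤ p) (x : ℝ) : |x| ^ (p - 2) * x ^ 2 = |x| ^ p := by
  rw [← sq_abs x, ← Real.rpow_natCast, ← Real.rpow_add_of_nonneg (abs_nonneg x) (by linarith)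
    (by norm_num)]
  norm_num

theorem abs_add_rpow_le (hp : 2 ≤ p) (x y : ℝ) :
    |x + y| ^ p ≤ |x| ^ p + p * (|x| ^ (p - 2) * x) * y +
      taylorConst p * (|x| ^ (p - 2) * y ^ 2 + |y| ^ p) := by
  rcases eq_or_ne x 0 with rfl | hx
  · have hy : |y| ^ p ≤ taylorConst p * |y| ^ p :=
      le_mul_of_one_le_left (by positivity) (one_le_taylorConst hp)
    have hy2 : 0 ≤ taylorConst p * (|(0 : ℝ)| ^ (p - 2) * y ^ 2) := by
      have := one_le_taylorConst hp
      positivity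
    have h0 : (0 : ℝ) ≤ |(0 : ℝ)| ^ p := by positivity
    rw [zero_add]
    linarith
  obtain ⟨u, rfl⟩ : ∃ u, y = x * u := ⟨y / x, by field_simp⟩
  calc |x + x * u| ^ p = |x| ^ p * |1 + u| ^ p := by
        rw [← Real.mul_rpow (abs_nonneg _) (abs_nonneg _), ← abs_mul, mul_one_add]
    _ ≤ |x| ^ p * (1 + p * u + taylorConst p * (u ^ 2 + |u| ^ p)) := by
        gcongr
        exact abs_one_add_rpow_le hp u
    _ = _ := by
        rw [abs_mul, Real.mul_rpow (abs_nonneg _) (abs_nonneg _), ← abs_rpow_sub_two_mul_sq hp x]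
        ring

theorem abs_rpow_mul_sq_le (hp : 2 ≤ p) {τ : ℝ} (hτ : 0 < τ) (x z : ℝ) :
    |x| ^ (p - 2) * z ^ 2 ≤ |x| ^ p / τ + τ ^ (p / 2 - 1) * |z| ^ p := by
  rcases le_total (τ * z ^ 2) (x ^ 2) with h | h
  · refine le_add_of_le_of_nonneg ?_ (by positivity)
    rw [← abs_rpow_sub_two_mul_sq hp x, mul_div_assoc]
    gcongr
    rwa [le_div_iff₀' hτ]
  · refine le_add_of_nonneg_of_le (by positivity) ?_
    have hx : |x| ^ (p - 2) ≤ τ ^ (p / 2 - 1) * |z| ^ (p - 2) := by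
      rw [abs_rpow_eq_sq_rpow, abs_rpow_eq_sq_rpow, show (p - 2) / 2 = p / 2 - 1 by ring,
        ← Real.mul_rpow hτ.le (sq_nonneg z)]
      exact Real.rpow_le_rpow (sq_nonneg x) h (by linarith)
    rw [← abs_rpow_sub_two_mul_sq hp z, ← mul_assoc]
    gcongr

variable {Ω : Type*} [MeasurableSpace Ω] {P : Measure Ω}

variable {M Z J : Ω → ℝ}

theorem integrable_abs_rpow_mul_sq (hp : 2 ≤ p) (hM : MemLp M (ENNReal.ofReal p) P)
    (hZ : MemLp Z (ENNReal.ofReal p) P) : Integrable (fun ω => |M ω| ^ (p - 2) * Z ω ^ 2) P := by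
  have hM_meas := hM.1.aemeasurable
  have hZ_meas := hZ.1.aemeasurable
  have hmeas : AEMeasurable (fun ω => |M ω| ^ (p - 2) * Z ω ^ 2) P := by fun_prop
  have hdom := ((integrable_abs_rpow_of_memLp (by linarith) hM).div_const 1).add
    ((integrable_abs_rpow_of_memLp (by linarith) hZ).const_mul (1 ^ (p / 2 - 1)))
  refine hdom.mono' hmeas.aestronglyMeasurable (ae_of_all _ fun ω => ?_)
  rw [Real.norm_of_nonneg (by positivity)]
  exact abs_rpow_mul_sq_le hp one_pos _ _

theorem integral_abs_rpow_mul_sq_le (hp : 2 ≤ p) {τ : ℝ} (hτ : 0 < τ)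
    (hM : MemLp M (ENNReal.ofReal p) P) (hZ : MemLp Z (ENNReal.ofReal p) P) :
    ∫ ω, |M ω| ^ (p - 2) * Z ω ^ 2 ∂P ≤
      (∫ ω, |M ω| ^ p ∂P) / τ + τ ^ (p / 2 - 1) * ∫ ω, |Z ω| ^ p ∂P := by
  have hM_int := (integrable_abs_rpow_of_memLp (by linarith) hM).div_const τ
  have hZ_int := (integrable_abs_rpow_of_memLp (by linarith) hZ).const_mul (τ ^ (p / 2 - 1))
  rw [← integral_div, ← integral_const_mul, ← integral_add hM_int hZ_int]
  exact integral_mono (integrable_abs_rpow_mul_sq hp hM hZ) (hM_int.add hZ_int) fun ω =>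
    abs_rpow_mul_sq_le hp hτ _ _

theorem integrable_abs_rpow_mul_mul (hp : 2 ≤ p) (hM : MemLp M (ENNReal.ofReal p) P)
    (hZ : MemLp Z (ENNReal.ofReal p) P) :
    Integrable (fun ω => |M ω| ^ (p - 2) * M ω * Z ω) P := by
  have hM_meas := hM.1.aemeasurable
  have hZ_meas := hZ.1.aemeasurable
  have hmeas : AEMeasurable (fun ω => |M ω| ^ (p - 2) * M ω * Z ω) P := by fun_prop
  have hdom := (integrable_abs_rpow_mul_sq hp hM hM).add (integrable_abs_rpow_mul_sq hp hM hZ)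
  refine hdom.mono' hmeas.aestronglyMeasurable (ae_of_all _ fun ω => ?_)
  have hMZ : |M ω * Z ω| ≤ M ω ^ 2 + Z ω ^ 2 := by
    rw [abs_le]
    constructor <;> nlinarith [sq_nonneg (M ω + Z ω), sq_nonneg (M ω - Z ω)]
  rw [Real.norm_eq_abs, mul_assoc, abs_mul, abs_of_nonneg (by positivity), Pi.add_apply, ← mul_add]
  gcongr

theorem memLp_mul_of_indepFun (hp : 0 < p) (hZ : MemLp Z (ENNReal.ofReal p) P)
    (hJ : MemLp J (ENNReal.ofReal p) P) (hind : IndepFun Z J P) :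
    MemLp (fun ω => Z ω * J ω) (ENNReal.ofReal p) P := by
  have hpow : IndepFun (fun ω => |Z ω| ^ p) (fun ω => |J ω| ^ p) P :=
    hind.comp (φ := fun x => |x| ^ p) (ψ := fun x => |x| ^ p) (by fun_prop) (by fun_prop)
  refine (memLp_iff_integrable_abs_rpow (hZ.1.mul hJ.1) hp).2 ?_
  simp only [Pi.mul_apply, abs_mul, Real.mul_rpow (abs_nonneg _) (abs_nonneg _)]
  exact hpow.integrable_mul (integrable_abs_rpow_of_memLp hp hZ)
    (integrable_abs_rpow_of_memLp hp hJ)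

/-- Since `J` is centred and independent of `(M, Z)`, the first-order term of the Taylor expansion
of `|M + Z J| ^ p` integrates to zero. -/
theorem integral_abs_add_mul_rpow_le_taylor [IsFiniteMeasure P] (hp : 2 ≤ p)
    (hM : MemLp M (ENNReal.ofReal p) P) (hZ : MemLp Z (ENNReal.ofReal p) P)
    (hJ : MemLp J (ENNReal.ofReal p) P) (hind : IndepFun (fun ω => (M ω, Z ω)) J P)
    (hJ0 : ∫ ω, J ω ∂P = 0) :
    ∫ ω, |M ω + Z ω * J ω| ^ p ∂P ≤ ∫ ω, |M ω| ^ p ∂P + taylorConst p *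
      ((∫ ω, |M ω| ^ (p - 2) * Z ω ^ 2 ∂P) * ∫ ω, J ω ^ 2 ∂P +
        (∫ ω, |Z ω| ^ p ∂P) * ∫ ω, |J ω| ^ p ∂P) := by
  have hp0 : 0 < p := by linarith
  have hM_int := integrable_abs_rpow_of_memLp hp0 hM
  have hZ_int := integrable_abs_rpow_of_memLp hp0 hZ
  have hJ_int := integrable_abs_rpow_of_memLp hp0 hJ
  have hJ1_int : Integrable J P := (memLp_two_of_le hp hJ).integrable one_le_two
  have hJ2_int : Integrable (fun ω => J ω ^ 2) P := (memLp_two_of_le hp hJ).integrable_sq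
  have hMZ_int := integrable_abs_rpow_mul_mul hp hM hZ
  have hMZ2_int := integrable_abs_rpow_mul_sq hp hM hZ
  have hfirst : IndepFun (fun ω => |M ω| ^ (p - 2) * M ω * Z ω) J P :=
    hind.comp (φ := fun q : ℝ × ℝ => |q.1| ^ (p - 2) * q.1 * q.2) (ψ := id) (by fun_prop)
      measurable_id
  have hsecond : IndepFun (fun ω => |M ω| ^ (p - 2) * Z ω ^ 2) (fun ω => J ω ^ 2) P :=
    hind.comp (φ := fun q : ℝ × ℝ => |q.1| ^ (p - 2) * q.2 ^ 2) (ψ := fun x => x ^ 2)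
      (by fun_prop) (by fun_prop)
  have hlast : IndepFun (fun ω => |Z ω| ^ p) (fun ω => |J ω| ^ p) P :=
    hind.comp (φ := fun q : ℝ × ℝ => |q.2| ^ p) (ψ := fun x => |x| ^ p) (by fun_prop) (by fun_prop)
  have hfirst_int := (hfirst.integrable_mul hMZ_int hJ1_int).const_mul p
  have hrest_int := ((hsecond.integrable_mul hMZ2_int hJ2_int).add
    (hlast.integrable_mul hZ_int hJ_int)).const_mul (taylorConst p)
  have hZJ := memLp_mul_of_indepFun hp0 hZ hJ (hind.comp measurable_snd measurable_id)
  refine (integral_mono (integrable_abs_rpow_of_memLp hp0 (hM.add hZJ))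
    ((hM_int.add hfirst_int).add hrest_int) fun ω => ?_).trans_eq ?_
  · refine (abs_add_rpow_le hp (M ω) (Z ω * J ω)).trans_eq ?_
    simp only [Pi.add_apply, Pi.mul_apply, abs_mul, Real.mul_rpow (abs_nonneg _) (abs_nonneg _)]
    ring
  · rw [integral_add' (hM_int.add hfirst_int) hrest_int, integral_add' hM_int hfirst_int,
      integral_const_mul, integral_const_mul,
      hfirst.integral_mul_eq_mul_integral hMZ_int.1 hJ1_int.1,
      hJ0, mul_zero, mul_zero, add_zero,
      integral_add' (hsecond.integrable_mul hMZ2_int hJ2_int) (hlast.integrable_mul hZ_int hJ_int),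
      hsecond.integral_mul_eq_mul_integral hMZ2_int.1 hJ2_int.1,
      hlast.integral_mul_eq_mul_integral hZ_int.1 hJ_int.1]

/-- The factors of the martingale transform `∑ Zₖ Jₖ`: each increment `Jₖ` is centred, has moments
of order `δ` and is independent of the past partial sum and of its predictable factor `Zₖ`. -/
structure IsMartingaleTransform (P : Measure Ω) (p c δ K : ℝ) (N : ℕ) (Z J : ℕ → Ω → ℝ) : Prop where
  factor : ∀ k < N, HasMomentLE P p K (Z k)
  increment : ∀ k < N, HasMomentLE P p (c * δ) (J k)
  mean : ∀ k < N, ∫ ω, J k ω ∂P = 0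
  sq_le : ∀ k < N, ∫ ω, J k ω ^ 2 ∂P ≤ c * δ
  indep : ∀ k < N, IndepFun (fun ω => (∑ i ∈ Finset.range k, Z i ω * J i ω, Z k ω)) (J k) P

namespace IsMartingaleTransform

variable {c δ K V : ℝ} {N k : ℕ} {Z J : ℕ → Ω → ℝ}

theorem memLp (h : IsMartingaleTransform P p c δ K N Z J) (hp : 0 < p) (hk : k ≤ N) :
    MemLp (fun ω => ∑ i ∈ Finset.range k, Z i ω * J i ω) (ENNReal.ofReal p) P :=
  memLp_finsetSum _ fun i hi =>
    have hi : i < N := (Finset.mem_range.1 hi).trans_le hk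
    memLp_mul_of_indepFun hp (h.factor i hi).memLp (h.increment i hi).memLp
      ((h.indep i hi).comp measurable_snd measurable_id)

theorem moment_succ_le [IsFiniteMeasure P] (h : IsMartingaleTransform P p c δ K N Z J)
    (hp : 2 ≤ p) (hV : 0 < V) (hk : k < N) :
    ∫ ω, |∑ i ∈ Finset.range (k + 1), Z i ω * J i ω| ^ p ∂P ≤
      (1 + taylorConst p * (c * δ) / V) * ∫ ω, |∑ i ∈ Finset.range k, Z i ω * J i ω| ^ p ∂P +
        taylorConst p * (c * δ) * K * (V ^ (p / 2 - 1) + 1) := by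
  have hS := h.memLp (by linarith) hk.le
  set S := fun ω => ∑ i ∈ Finset.range k, Z i ω * J i ω
  have hD := one_le_taylorConst hp
  have hK : 0 ≤ K := (h.factor k hk).nonneg
  have hmixed := integral_abs_rpow_mul_sq_le hp hV hS (h.factor k hk).memLp
  have hmixed' : ∫ ω, |S ω| ^ (p - 2) * Z k ω ^ 2 ∂P ≤
      (∫ ω, |S ω| ^ p ∂P) / V + V ^ (p / 2 - 1) * K :=
    hmixed.trans (by gcongr; exact (h.factor k hk).integral_le)
  simp_rw [Finset.sum_range_succ]
  calc ∫ ω, |S ω + Z k ω * J k ω| ^ p ∂P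
      ≤ ∫ ω, |S ω| ^ p ∂P + taylorConst p *
          ((∫ ω, |S ω| ^ (p - 2) * Z k ω ^ 2 ∂P) * ∫ ω, J k ω ^ 2 ∂P +
            (∫ ω, |Z k ω| ^ p ∂P) * ∫ ω, |J k ω| ^ p ∂P) :=
        integral_abs_add_mul_rpow_le_taylor hp hS (h.factor k hk).memLp (h.increment k hk).memLp
          (h.indep k hk) (h.mean k hk)
    _ ≤ ∫ ω, |S ω| ^ p ∂P + taylorConst p *
          (((∫ ω, |S ω| ^ p ∂P) / V + V ^ (p / 2 - 1) * K) * (c * δ) + K * (c * δ)) := by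
        gcongr
        · exact h.sq_le k hk
        · exact (h.factor k hk).integral_le
        · exact (h.increment k hk).integral_le
    _ = _ := by ring

/-- A Rosenthal type inequality: Gronwall's lemma applied to `moment_succ_le`. -/
theorem hasMomentLE_sum [IsFiniteMeasure P] (h : IsMartingaleTransform P p c δ K N Z J)
    (hp : 2 ≤ p) (hc : 0 ≤ c) (hδ : 0 ≤ δ) (hK : 0 ≤ K) (hV : 0 < V) (hN : N * δ ≤ V) :
    HasMomentLE P p (Real.exp (taylorConst p * c) * (taylorConst p * c * K) * (V + V ^ (p / 2)))
      fun ω => ∑ i ∈ Finset.range N, Z i ω * J i ω := by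
  refine ⟨h.memLp (by linarith) le_rfl, ?_⟩
  have hD := one_le_taylorConst hp
  set u : ℕ → ℝ := fun k => ∫ ω, |∑ i ∈ Finset.range k, Z i ω * J i ω| ^ p ∂P
  set growth := taylorConst p * (c * δ) / V
  set source := taylorConst p * (c * δ) * K * (V ^ (p / 2 - 1) + 1)
  have hu0 : u 0 = 0 := by simp [u, Real.zero_rpow (by linarith : p ≠ 0)]
  have hu : ∀ k, 0 ≤ u k := fun k => integral_nonneg fun ω => by positivity
  have hgrowth : 0 ≤ growth := by positivity
  have hsource : 0 ≤ source := by positivity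
  have hrec (k : ℕ) : u (min (k + 1) N) ≤ (1 + growth) * u (min k N) + source := by
    rcases lt_or_ge k N with hk | hk
    · rw [min_eq_left hk.le, min_eq_left (Nat.succ_le_of_lt hk)]
      exact h.moment_succ_le hp hV hk
    · rw [min_eq_right hk, min_eq_right (hk.trans k.le_succ)]
      nlinarith [hu N, mul_nonneg hgrowth (hu N)]
  have hgronwall := discrete_gronwall (u := fun k => u (min k N)) (c := fun _ => growth)
    (b := fun _ => source) (hu _) (fun k _ => hrec k) (fun _ _ => hgrowth) (fun _ _ => hsource)
    N.zero_le
  have hgrowth_le : N * growth ≤ taylorConst p * c := by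
    calc N * growth = taylorConst p * c * (N * δ / V) := by ring
      _ ≤ taylorConst p * c * 1 := by gcongr; exact div_le_one_of_le₀ hN hV.le
      _ = taylorConst p * c := mul_one _
  simp only [min_self, Nat.zero_min, hu0, zero_add, Finset.sum_const, Nat.card_Ico, tsub_zero,
    nsmul_eq_mul] at hgronwall
  calc u N ≤ N * source * Real.exp (N * growth) := hgronwall
    _ = Real.exp (N * growth) * (taylorConst p * c * K) * (N * δ * (V ^ (p / 2 - 1) + 1)) := by ring
    _ ≤ Real.exp (taylorConst p * c) * (taylorConst p * c * K) * (V * (V ^ (p / 2 - 1) + 1)) := by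
        gcongr
    _ = _ := by
        rw [show p / 2 = p / 2 - 1 + 1 by ring, Real.rpow_add_one hV.ne', add_sub_cancel_right]
        ring

end IsMartingaleTransform

end Rosenthal

/-! ### Sums of independent cells -/

section Cells

variable {Ω ι : Type*}

/-- The σ-algebra generated by the cells in `S`. -/
abbrev cellAlgebra (ξ : ι → Ω → ℝ) (S : Set ι) : MeasurableSpace Ω :=
  ⨆ q ∈ S, MeasurableSpace.comap (ξ q) inferInstance

/-- The sum of the cells in `S`. -/
def cellSum (ξ : ι → Ω → ℝ) (S : Finset ι) (ω : Ω) : ℝ := ∑ q ∈ S, ξ q ω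

/-- The sum of the products of the cell sums over `S i` and `T i`, `i < N`. -/
def bilinearSum (ξ : ι → Ω → ℝ) (N : ℕ) (S T : ℕ → Finset ι) (ω : Ω) : ℝ :=
  ∑ i ∈ Finset.range N, cellSum ξ (S i) ω * cellSum ξ (T i) ω

theorem cellAlgebra_mono (ξ : ι → Ω → ℝ) {S T : Set ι} (hST : S ⊆ T) :
    cellAlgebra ξ S ≤ cellAlgebra ξ T :=
  biSup_mono fun _ hq => hST hq

theorem measurable_cellSum (ξ : ι → Ω → ℝ) {S : Finset ι} {T : Set ι} (hST : ↑S ⊆ T) :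
    Measurable[cellAlgebra ξ T] (cellSum ξ S) :=
  Finset.measurable_sum _ fun q hq => (comap_measurable (ξ q)).mono
    (le_biSup (fun q => MeasurableSpace.comap (ξ q) inferInstance) (hST hq)) le_rfl

variable [MeasurableSpace Ω] {P : Measure Ω}

theorem indepFun_sum_mul_of_cells {ξ : ι → Ω → ℝ} (hξ : ∀ q, Measurable (ξ q))
    (hindep : iIndepFun ξ P) {Z J : ℕ → Ω → ℝ} {S T : ℕ → Set ι} {k : ℕ}
    (hZ : ∀ i ≤ k, Measurable[cellAlgebra ξ (S i)] (Z i))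
    (hJ : ∀ i ≤ k, Measurable[cellAlgebra ξ (T i)] (J i))
    (hST : ∀ i ≤ k, Disjoint (S i) (T k)) (hTT : ∀ i < k, Disjoint (T i) (T k)) :
    IndepFun (fun ω => (∑ i ∈ Finset.range k, Z i ω * J i ω, Z k ω)) (J k) P := by
  have hcells : Indep (cellAlgebra ξ (T k)ᶜ) (cellAlgebra ξ (T k)) P :=
    indep_iSup_of_disjoint (fun q => (hξ q).comap_le) hindep disjoint_compl_left
  have hZ_past (i) (hi : i ≤ k) : Measurable[cellAlgebra ξ (T k)ᶜ] (Z i) :=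
    (hZ i hi).mono (cellAlgebra_mono ξ (hST i hi).subset_compl_right) le_rfl
  have hJ_past (i) (hi : i < k) : Measurable[cellAlgebra ξ (T k)ᶜ] (J i) :=
    (hJ i hi.le).mono (cellAlgebra_mono ξ (hTT i hi).subset_compl_right) le_rfl
  have hpast : Measurable[cellAlgebra ξ (T k)ᶜ]
      (fun ω => (∑ i ∈ Finset.range k, Z i ω * J i ω, Z k ω)) := by
    refine Measurable.prodMk (Finset.measurable_sum _ fun i hi => ?_) (hZ_past k le_rfl)
    have hi := Finset.mem_range.1 hi
    exact (hZ_past i hi.le).mul (hJ_past i hi)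
  rw [IndepFun_iff_Indep]
  exact indep_of_indep_of_le_left (indep_of_indep_of_le_right hcells (hJ k le_rfl).comap_le)
    hpast.comap_le

/-- Independent centred variables `ξ q` with weights `w q`, such that the variance of a cell sum is
its total weight, and so is its `2p`-th moment up to the factor `C`, if the weight is at most
`V`. -/
structure CellModel (P : Measure Ω) (ξ : ι → Ω → ℝ) (w : ι → ℝ) (p V C : ℝ) : Prop where
  measurable : ∀ q, Measurable (ξ q)
  indep : iIndepFun ξ P
  weight_nonneg : ∀ q, 0 ≤ w q
  memLp : ∀ q, MemLp (ξ q) (ENNReal.ofReal (2 * p)) P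
  mean : ∀ q, ∫ ω, ξ q ω ∂P = 0
  sq : ∀ S, ∫ ω, cellSum ξ S ω ^ 2 ∂P = ∑ q ∈ S, w q
  moment_le : ∀ S, ∑ q ∈ S, w q ≤ V → ∫ ω, |cellSum ξ S ω| ^ (2 * p) ∂P ≤ C * ∑ q ∈ S, w q

/-- The moment constant in `CellModel.hasMomentLE_bilinearSum`. -/
noncomputable def bilinearConst (p V C : ℝ) : ℝ :=
  Real.exp (taylorConst p * (2 ^ p * (1 + C))) *
    (taylorConst p * (2 ^ p * (1 + C)) * ((1 + C) * V + 1))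

theorem bilinearConst_nonneg {p V C : ℝ} (hp : 2 ≤ p) (hV : 0 ≤ V) (hC : 0 ≤ C) :
    0 ≤ bilinearConst p V C := by
  have := one_le_taylorConst hp
  rw [bilinearConst]
  positivity

theorem abs_rpow_le_sq_add_rpow {r R : ℝ} (hr : 2 ≤ r) (hrR : r ≤ R) (x : ℝ) :
    |x| ^ r ≤ x ^ 2 + |x| ^ R := by
  rcases le_total |x| 1 with hx | hx
  · refine le_add_of_le_of_nonneg ?_ (by positivity)
    rw [← sq_abs, ← Real.rpow_two]
    exact Real.rpow_le_rpow_of_exponent_ge_of_imp (abs_nonneg x) hx hr (by intros; linarith)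
  · exact le_add_of_nonneg_of_le (sq_nonneg x) (Real.rpow_le_rpow_of_exponent_le hx hrR)

namespace CellModel

variable {ξ : ι → Ω → ℝ} {w : ι → ℝ} {p V C δ r H : ℝ} {S T : Finset ι} {N : ℕ}

theorem weight_mono (h : CellModel P ξ w p V C) (hST : S ⊆ T) :
    ∑ q ∈ S, w q ≤ ∑ q ∈ T, w q :=
  Finset.sum_le_sum_of_subset_of_nonneg hST fun q _ _ => h.weight_nonneg q

theorem memLp_cellSum (h : CellModel P ξ w p V C) (S : Finset ι) :
    MemLp (cellSum ξ S) (ENNReal.ofReal (2 * p)) P :=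
  memLp_finsetSum S fun q _ => h.memLp q

variable [IsProbabilityMeasure P]

theorem memLp_two (h : CellModel P ξ w p V C) (hp : 1 ≤ p) (S : Finset ι) :
    MemLp (cellSum ξ S) 2 P :=
  memLp_two_of_le (by linarith) (h.memLp_cellSum S)

theorem mean_cellSum (h : CellModel P ξ w p V C) (hp : 1 ≤ p) (S : Finset ι) :
    ∫ ω, cellSum ξ S ω ∂P = 0 := by
  have hint (q) (_ : q ∈ S) : Integrable (ξ q) P :=
    (memLp_two_of_le (by linarith) (h.memLp q)).integrable one_le_two
  simp only [cellSum, integral_finsetSum S hint, h.mean, Finset.sum_const_zero]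

theorem hasMomentLE_cellSum (h : CellModel P ξ w p V C) (hr : 2 ≤ r) (hrp : r ≤ 2 * p)
    (hS : ∑ q ∈ S, w q ≤ V) : HasMomentLE P r ((1 + C) * ∑ q ∈ S, w q) (cellSum ξ S) := by
  have hmem : MemLp (cellSum ξ S) (ENNReal.ofReal r) P :=
    (h.memLp_cellSum S).mono_exponent (ENNReal.ofReal_le_ofReal hrp)
  have hsq_int := (memLp_two_of_le hr hmem).integrable_sq
  have hpow_int := integrable_abs_rpow_of_memLp (by linarith) (h.memLp_cellSum S)
  refine ⟨hmem, ?_⟩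
  calc ∫ ω, |cellSum ξ S ω| ^ r ∂P
      ≤ ∫ ω, (cellSum ξ S ω ^ 2 + |cellSum ξ S ω| ^ (2 * p)) ∂P :=
        integral_mono (integrable_abs_rpow_of_memLp (by linarith) hmem) (hsq_int.add hpow_int)
          fun ω => abs_rpow_le_sq_add_rpow hr hrp _
    _ = ∑ q ∈ S, w q + ∫ ω, |cellSum ξ S ω| ^ (2 * p) ∂P := by
        rw [integral_add hsq_int hpow_int, h.sq]
    _ ≤ (1 + C) * ∑ q ∈ S, w q := by linarith [h.moment_le S hS]

theorem hasMomentLE_cellSum_of_le (h : CellModel P ξ w p V C) (hC : 0 ≤ C) (hr : 2 ≤ r)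
    (hrp : r ≤ 2 * p) (hS : ∑ q ∈ S, w q ≤ V) (hδ : ∑ q ∈ S, w q ≤ δ) :
    HasMomentLE P r ((1 + C) * δ) (cellSum ξ S) :=
  (h.hasMomentLE_cellSum hr hrp hS).mono (by gcongr)

theorem integral_mul_of_subset (h : CellModel P ξ w p V C) (hp : 1 ≤ p) (hST : S ⊆ T) :
    ∫ ω, cellSum ξ S ω * cellSum ξ T ω ∂P = ∑ q ∈ S, w q := by
  classical
  have hS_int := (h.memLp_two hp S).integrable_sq
  have hT_int := (h.memLp_two hp T).integrable_sq
  have hST_int : Integrable (fun ω => cellSum ξ (T \ S) ω ^ 2) P :=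
    (h.memLp_two hp (T \ S)).integrable_sq
  have hpolar (ω : Ω) : cellSum ξ S ω * cellSum ξ T ω =
      (cellSum ξ S ω ^ 2 + cellSum ξ T ω ^ 2 - cellSum ξ (T \ S) ω ^ 2) / 2 := by
    rw [show cellSum ξ (T \ S) ω = cellSum ξ T ω - cellSum ξ S ω from
      Finset.sum_sdiff_eq_sub hST]
    ring
  have hsum_int : Integrable (fun ω => cellSum ξ S ω ^ 2 + cellSum ξ T ω ^ 2) P :=
    hS_int.add hT_int
  simp_rw [hpolar]
  rw [integral_div, integral_sub hsum_int hST_int, integral_add hS_int hT_int, h.sq, h.sq, h.sq,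
    Finset.sum_sdiff_eq_sub hST]
  ring

theorem hasMomentLE_product (h : CellModel P ξ w p V C) (hC : 0 ≤ C) (hr : 1 ≤ r) (hrp : r ≤ p)
    (hST : S ⊆ T) (hV : ∑ q ∈ T, w q ≤ V) (hδ : ∑ q ∈ T, w q ≤ δ) :
    HasMomentLE P r ((1 + C) * δ) fun ω => cellSum ξ S ω * cellSum ξ T ω := by
  have hSw := h.weight_mono hST
  have hS := h.hasMomentLE_cellSum_of_le (r := 2 * r) hC (by linarith) (by linarith)
    (hSw.trans hV) (hSw.trans hδ)
  have hT := h.hasMomentLE_cellSum_of_le (r := 2 * r) hC (by linarith) (by linarith) hV hδ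
  simpa using hS.mul (by linarith) hT

theorem hasMomentLE_centered_product (h : CellModel P ξ w p V C) (hC : 0 ≤ C) (hr : 1 ≤ r)
    (hrp : r ≤ p) (hST : S ⊆ T) (hV : ∑ q ∈ T, w q ≤ V) (hδ : ∑ q ∈ T, w q ≤ δ) :
    HasMomentLE P r (2 ^ r * ((1 + C) * δ))
      fun ω => cellSum ξ S ω * cellSum ξ T ω - ∑ q ∈ S, w q := by
  simpa only [h.integral_mul_of_subset (hr.trans hrp) hST] using
    (h.hasMomentLE_product hC hr hrp hST hV hδ).sub_integral hr

variable {S T : ℕ → Finset ι}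

theorem isMartingaleTransform_cellSum (h : CellModel P ξ w p V C) (hp : 2 ≤ p) (hC : 0 ≤ C)
    (hδ : 0 ≤ δ) (hS : ∀ k < N, ∑ q ∈ S k, w q ≤ V) (hTV : ∀ k < N, ∑ q ∈ T k, w q ≤ V)
    (hT : ∀ k < N, ∑ q ∈ T k, w q ≤ δ) (hST : ∀ k < N, ∀ i ≤ k, Disjoint (S i) (T k))
    (hTT : ∀ k < N, ∀ i < k, Disjoint (T i) (T k)) :
    IsMartingaleTransform P p (2 ^ p * (1 + C)) δ ((1 + C) * V + 1) N
      (fun k => cellSum ξ (S k)) (fun k => cellSum ξ (T k)) := by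
  have hC' : 1 + C ≤ 2 ^ p * (1 + C) :=
    le_mul_of_one_le_left (by positivity) (Real.one_le_rpow one_le_two (by linarith))
  exact {
    factor := fun k hk => (h.hasMomentLE_cellSum_of_le hC hp (by linarith) (hS k hk)
      (hS k hk)).mono (by linarith)
    increment := fun k hk => (h.hasMomentLE_cellSum_of_le hC hp (by linarith) (hTV k hk)
      (hT k hk)).mono (by gcongr)
    mean := fun k _ => h.mean_cellSum (by linarith) (T k)
    sq_le := fun k hk => by
      rw [h.sq]
      exact (hT k hk).trans (le_mul_of_one_le_left hδ (by linarith))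
    indep := fun k hk => indepFun_sum_mul_of_cells h.measurable h.indep
      (S := fun i => (S i : Set ι)) (T := fun i => (T i : Set ι))
      (fun i _ => measurable_cellSum ξ subset_rfl) (fun i _ => measurable_cellSum ξ subset_rfl)
      (fun i hi => Finset.disjoint_coe.2 (hST k hk i hi))
      (fun i hi => Finset.disjoint_coe.2 (hTT k hk i hi)) }

theorem hasMomentLE_bilinearSum (h : CellModel P ξ w p V C) (hp : 2 ≤ p) (hC : 0 ≤ C)
    (hV : 0 ≤ V) (hδ : 0 ≤ δ) (hH : 0 < H) (hN : N * δ ≤ H)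
    (hS : ∀ k < N, ∑ q ∈ S k, w q ≤ V) (hTV : ∀ k < N, ∑ q ∈ T k, w q ≤ V)
    (hT : ∀ k < N, ∑ q ∈ T k, w q ≤ δ)
    (hST : ∀ k < N, ∀ i ≤ k, Disjoint (S i) (T k))
    (hTT : ∀ k < N, ∀ i < k, Disjoint (T i) (T k)) :
    HasMomentLE P p (bilinearConst p V C * (H + H ^ (p / 2))) (bilinearSum ξ N S T) :=
  (h.isMartingaleTransform_cellSum hp hC hδ hS hTV hT hST hTT).hasMomentLE_sum hp (by positivity)
    hδ (by positivity) hH hN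

theorem isMartingaleTransform_centered_product (h : CellModel P ξ w p V C) (hp : 2 ≤ p)
    (hC : 0 ≤ C) (hV : 0 ≤ V) (hδ : 0 ≤ δ) (hST : ∀ k, S k ⊆ T k)
    (hTV : ∀ k < N, ∑ q ∈ T k, w q ≤ V) (hT : ∀ k < N, ∑ q ∈ T k, w q ≤ δ)
    (hTT : ∀ k < N, ∀ i < k, Disjoint (T i) (T k)) :
    IsMartingaleTransform P p (2 ^ p * (1 + C)) δ ((1 + C) * V + 1) N (fun _ _ => 1)
      (fun k ω => cellSum ξ (S k) ω * cellSum ξ (T k) ω - ∑ q ∈ S k, w q) where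
  factor k _ := ⟨memLp_const 1, by simpa using by positivity⟩
  increment k hk := (h.hasMomentLE_centered_product hC (by linarith) le_rfl (hST k) (hTV k hk)
    (hT k hk)).mono (mul_assoc _ _ _).ge
  mean k _ := by
    have hint : Integrable (fun ω => cellSum ξ (S k) ω * cellSum ξ (T k) ω) P :=
      (h.memLp_two (by linarith) (S k)).integrable_mul (h.memLp_two (by linarith) (T k))
    rw [integral_sub hint (integrable_const _), integral_const, probReal_univ, one_smul,
      h.integral_mul_of_subset (by linarith) (hST k), sub_self]
  sq_le k hk := by
    have hsq := (h.hasMomentLE_centered_product hC one_le_two hp (hST k) (hTV k hk)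
      (hT k hk)).integral_le
    simp_rw [Real.rpow_two (|_|), sq_abs] at hsq
    refine hsq.trans ?_
    rw [← mul_assoc]
    gcongr
    exact one_le_two
  indep k hk := indepFun_sum_mul_of_cells h.measurable h.indep
    (S := fun _ => ∅) (T := fun i => (T i : Set ι)) (fun i _ => measurable_const)
    (fun i _ => ((measurable_cellSum ξ (Finset.coe_subset.2 (hST i))).mul
      (measurable_cellSum ξ subset_rfl)).sub_const _)
    (fun i _ => disjoint_bot_left) (fun i hi => Finset.disjoint_coe.2 (hTT k hk i hi))

theorem hasMomentLE_sum_centered_product (h : CellModel P ξ w p V C) (hp : 2 ≤ p) (hC : 0 ≤ C)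
    (hV : 0 ≤ V) (hδ : 0 ≤ δ) (hH : 0 < H) (hN : N * δ ≤ H) (hST : ∀ k, S k ⊆ T k)
    (hTV : ∀ k < N, ∑ q ∈ T k, w q ≤ V) (hT : ∀ k < N, ∑ q ∈ T k, w q ≤ δ)
    (hTT : ∀ k < N, ∀ i < k, Disjoint (T i) (T k)) :
    HasMomentLE P p (bilinearConst p V C * (H + H ^ (p / 2))) fun ω =>
      ∑ i ∈ Finset.range N, (cellSum ξ (S i) ω * cellSum ξ (T i) ω - ∑ q ∈ S i, w q) := by
  simpa only [one_mul, bilinearConst] using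
    (h.isMartingaleTransform_centered_product hp hC hV hδ hST hTV hT hTT).hasMomentLE_sum hp
      (by positivity) hδ (by positivity) hH hN

end CellModel

end Cells

/-! ### Lagged products of a birth-and-death process of cells -/

/-- The sum of lagged products `∑_{k=l}^{n-1} (x_{k-l} - x̄) (x_{k+1} - x_k)`. -/
noncomputable def laggedSum (n l : ℕ) (x : ℕ → ℝ) : ℝ :=
  ∑ k ∈ Finset.Ico l n, (x (k - l) - 1 / (n : ℝ) * ∑ k ∈ Finset.range n, x k) * (x (k + 1) - x k)

section Grid

variable {Ω : Type*}

/-- The index set of all cells up to time `n`; the cell `(i, j)` is born at time `i` and dies after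
time `j`. -/
def grid (n : ℕ) : Finset (ℕ × ℕ) := Finset.range (n + 1) ×ˢ Finset.range (n + 1)

/-- The cells that are alive at time `k`. -/
def aliveCells (n k : ℕ) : Finset (ℕ × ℕ) := (grid n).filter fun q => q.1 ≤ k ∧ k ≤ q.2

/-- The cells born at time `k`. -/
def bornCells (n k : ℕ) : Finset (ℕ × ℕ) := (grid n).filter fun q => q.1 = k ∧ k ≤ q.2

/-- The cells born up to time `m` that die after time `k`. -/
def dyingCells (n m k : ℕ) : Finset (ℕ × ℕ) := (grid n).filter fun q => q.1 ≤ m ∧ q.2 = k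

/-- The cells born up to time `m` that outlive time `k`. -/
def survivingCells (n m k : ℕ) : Finset (ℕ × ℕ) := (grid n).filter fun q => q.1 ≤ m ∧ k < q.2

/-- The cells alive at time `m` that die before time `k`. -/
def earlyCells (n m k : ℕ) : Finset (ℕ × ℕ) :=
  (grid n).filter fun q => q.1 ≤ m ∧ m ≤ q.2 ∧ q.2 < k

theorem cellSum_alive_succ (ξ : ℕ × ℕ → Ω → ℝ) (n k : ℕ) (ω : Ω) :
    cellSum ξ (aliveCells n (k + 1)) ω - cellSum ξ (aliveCells n k) ω =
      cellSum ξ (bornCells n (k + 1)) ω - cellSum ξ (dyingCells n k k) ω := by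
  simp only [cellSum, aliveCells, bornCells, dyingCells, Finset.sum_filter,
    ← Finset.sum_sub_distrib]
  refine Finset.sum_congr rfl fun q _ => ?_
  split_ifs <;> first | omega | simp

theorem cellSum_alive_eq (ξ : ℕ × ℕ → Ω → ℝ) (n : ℕ) {m k : ℕ} (hmk : m ≤ k) (ω : Ω) :
    cellSum ξ (aliveCells n m) ω = cellSum ξ (survivingCells n m k) ω +
      cellSum ξ (dyingCells n m k) ω + cellSum ξ (earlyCells n m k) ω := by
  simp only [cellSum, aliveCells, survivingCells, dyingCells, earlyCells, Finset.sum_filter,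
    ← Finset.sum_add_distrib]
  refine Finset.sum_congr rfl fun q _ => ?_
  split_ifs <;> first | omega | simp

theorem sum_mul_sub_eq_mul_sub (c : ℝ) (x : ℕ → ℝ) {l n : ℕ} (hl : l ≤ n) :
    ∑ i ∈ Finset.range (n - l), c * (x (l + i + 1) - x (l + i)) = c * (x n - x l) := by
  have htelescope := Finset.sum_range_sub (fun i => x (l + i)) (n - l)
  rw [add_zero, Nat.add_sub_cancel' hl] at htelescope
  rw [← Finset.mul_sum, ← htelescope]
  rfl

theorem laggedSum_alive_add_eq (ξ : ℕ × ℕ → Ω → ℝ) (w : ℕ × ℕ → ℝ) {n l : ℕ} (hl : l ≤ n) (ω : Ω) :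
    laggedSum n l (fun k => cellSum ξ (aliveCells n k) ω) +
        ∑ k ∈ Finset.Ico l n, ∑ q ∈ dyingCells n (k - l) k, w q =
      bilinearSum ξ (n - l) (aliveCells n) (fun i => bornCells n (l + i + 1)) ω
      - bilinearSum ξ (n - l) (fun i => earlyCells n i (l + i))
          (fun i => dyingCells n (l + i) (l + i)) ω
      - bilinearSum ξ (n - l) (fun i => survivingCells n i (l + i))
          (fun i => dyingCells n (l + i) (l + i)) ω
      - ∑ i ∈ Finset.range (n - l), (cellSum ξ (dyingCells n i (l + i)) ω *
          cellSum ξ (dyingCells n (l + i) (l + i)) ω - ∑ q ∈ dyingCells n i (l + i), w q)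
      - (1 / (n : ℝ) * ∑ k ∈ Finset.range n, cellSum ξ (aliveCells n k) ω) *
          (cellSum ξ (aliveCells n n) ω - cellSum ξ (aliveCells n l) ω) := by
  rw [← sum_mul_sub_eq_mul_sub _ (fun k => cellSum ξ (aliveCells n k) ω) hl, laggedSum,
    Finset.sum_Ico_eq_sum_range, Finset.sum_Ico_eq_sum_range]
  simp only [bilinearSum, ← Finset.sum_sub_distrib, ← Finset.sum_add_distrib]
  refine Finset.sum_congr rfl fun i _ => ?_
  rw [Nat.add_sub_cancel_left, sub_mul, cellSum_alive_succ,
    cellSum_alive_eq ξ n (Nat.le_add_left i l)]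
  ring

/-- Up to time `n`, at any time the living cells weigh at most `V`, and the cells born and the
cells that die at most `δ`. -/
structure GridBounds (w : ℕ × ℕ → ℝ) (n : ℕ) (V δ : ℝ) : Prop where
  alive_le : ∀ k ≤ n, ∑ q ∈ aliveCells n k, w q ≤ V
  born_le : ∀ k < n, ∑ q ∈ bornCells n (k + 1), w q ≤ δ
  dying_le : ∀ k < n, ∑ q ∈ dyingCells n k k, w q ≤ δ

/-- The moment constant in `CellModel.hasMomentLE_laggedSum`. -/
noncomputable def laggedConst (p V C : ℝ) : ℝ :=
  5 ^ p * (bilinearConst p V C + (1 + 2 ^ (2 * p)) / 2 * ((1 + C) * V))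

theorem laggedConst_nonneg {p V C : ℝ} (hp : 2 ≤ p) (hV : 0 ≤ V) (hC : 0 ≤ C) :
    0 ≤ laggedConst p V C := by
  have := bilinearConst_nonneg hp hV hC
  rw [laggedConst]
  positivity

namespace CellModel

variable [MeasurableSpace Ω] {P : Measure Ω} {ξ : ℕ × ℕ → Ω → ℝ} {w : ℕ × ℕ → ℝ}
  {p V C δ : ℝ} {n l : ℕ}

theorem sum_le_of_subset_alive (h : CellModel P ξ w p V C) (hw : GridBounds w n V δ)
    {S : Finset (ℕ × ℕ)} {k : ℕ} (hk : k ≤ n) (hS : S ⊆ aliveCells n k) : ∑ q ∈ S, w q ≤ V :=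
  (h.weight_mono hS).trans (hw.alive_le k hk)

theorem sum_dying_le (h : CellModel P ξ w p V C) (hw : GridBounds w n V δ) {k : ℕ} (hk : k < n) :
    ∑ q ∈ dyingCells n k k, w q ≤ V :=
  h.sum_le_of_subset_alive hw hk.le (Finset.monotone_filter_right _ fun q _ _ => by omega)

theorem bound_nonneg (h : CellModel P ξ w p V C) (hw : GridBounds w n V δ) : 0 ≤ V :=
  (Finset.sum_nonneg fun q _ => h.weight_nonneg q).trans (hw.alive_le 0 n.zero_le)

variable [IsProbabilityMeasure P]

theorem hasMomentLE_alive_born (h : CellModel P ξ w p V C) (hw : GridBounds w n V δ)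
    (hp : 2 ≤ p) (hC : 0 ≤ C) (hδ : 0 < δ) (hn : 0 < n) (l : ℕ) :
    HasMomentLE P p (bilinearConst p V C * (n * δ + (n * δ) ^ (p / 2)))
      (bilinearSum ξ (n - l) (aliveCells n) fun i => bornCells n (l + i + 1)) :=
  h.hasMomentLE_bilinearSum hp hC (h.bound_nonneg hw) hδ.le (by positivity)
    (by gcongr; exact Nat.sub_le n l)
    (fun k _ => hw.alive_le k (by omega))
    (fun k _ => h.sum_le_of_subset_alive hw (k := l + k + 1) (by omega)
      (Finset.monotone_filter_right _ fun q _ _ => by omega))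
    (fun k _ => hw.born_le (l + k) (by omega))
    (fun k _ i _ => Finset.disjoint_filter.2 fun q _ _ _ => by omega)
    (fun k _ i _ => Finset.disjoint_filter.2 fun q _ _ _ => by omega)

theorem hasMomentLE_early_dying (h : CellModel P ξ w p V C) (hw : GridBounds w n V δ)
    (hp : 2 ≤ p) (hC : 0 ≤ C) (hδ : 0 < δ) (hn : 0 < n) (l : ℕ) :
    HasMomentLE P p (bilinearConst p V C * (n * δ + (n * δ) ^ (p / 2)))
      (bilinearSum ξ (n - l) (fun i => earlyCells n i (l + i))
        fun i => dyingCells n (l + i) (l + i)) :=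
  h.hasMomentLE_bilinearSum hp hC (h.bound_nonneg hw) hδ.le (by positivity)
    (by gcongr; exact Nat.sub_le n l)
    (fun k _ => h.sum_le_of_subset_alive hw (k := k) (by omega)
      (Finset.monotone_filter_right _ fun q _ _ => by omega))
    (fun k _ => h.sum_dying_le hw (by omega))
    (fun k _ => hw.dying_le (l + k) (by omega))
    (fun k _ i _ => Finset.disjoint_filter.2 fun q _ _ _ => by omega)
    (fun k _ i _ => Finset.disjoint_filter.2 fun q _ _ _ => by omega)

-- The surviving cells are independent of the later deaths, so this sum is a martingale transform
-- only when time runs backwards.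
theorem hasMomentLE_surviving_dying (h : CellModel P ξ w p V C) (hw : GridBounds w n V δ)
    (hp : 2 ≤ p) (hC : 0 ≤ C) (hδ : 0 < δ) (hn : 0 < n) (l : ℕ) :
    HasMomentLE P p (bilinearConst p V C * (n * δ + (n * δ) ^ (p / 2)))
      (bilinearSum ξ (n - l) (fun i => survivingCells n i (l + i))
        fun i => dyingCells n (l + i) (l + i)) := by
  have hreversed : bilinearSum ξ (n - l) (fun i => survivingCells n i (l + i))
        (fun i => dyingCells n (l + i) (l + i)) =
      bilinearSum ξ (n - l) (fun i => survivingCells n (n - l - 1 - i) (l + (n - l - 1 - i)))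
        (fun i => dyingCells n (l + (n - l - 1 - i)) (l + (n - l - 1 - i))) :=
    funext fun ω => (Finset.sum_range_reflect (fun i => cellSum ξ (survivingCells n i (l + i)) ω *
      cellSum ξ (dyingCells n (l + i) (l + i)) ω) (n - l)).symm
  rw [hreversed]
  exact h.hasMomentLE_bilinearSum hp hC (h.bound_nonneg hw) hδ.le (by positivity)
    (by gcongr; exact Nat.sub_le n l)
    (fun k _ => h.sum_le_of_subset_alive hw (k := n - l - 1 - k) (by omega)
      (Finset.monotone_filter_right _ fun q _ _ => by omega))
    (fun k _ => h.sum_dying_le hw (by omega))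
    (fun k _ => hw.dying_le (l + (n - l - 1 - k)) (by omega))
    (fun k _ i _ => Finset.disjoint_filter.2 fun q _ _ _ => by omega)
    (fun k _ i _ => Finset.disjoint_filter.2 fun q _ _ _ => by omega)

theorem hasMomentLE_centered_dying_dying (h : CellModel P ξ w p V C) (hw : GridBounds w n V δ)
    (hp : 2 ≤ p) (hC : 0 ≤ C) (hδ : 0 < δ) (hn : 0 < n) (l : ℕ) :
    HasMomentLE P p (bilinearConst p V C * (n * δ + (n * δ) ^ (p / 2))) fun ω =>
      ∑ i ∈ Finset.range (n - l), (cellSum ξ (dyingCells n i (l + i)) ω *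
        cellSum ξ (dyingCells n (l + i) (l + i)) ω - ∑ q ∈ dyingCells n i (l + i), w q) :=
  h.hasMomentLE_sum_centered_product hp hC (h.bound_nonneg hw) hδ.le (by positivity)
    (by gcongr; exact Nat.sub_le n l)
    (fun k => Finset.monotone_filter_right _ fun q _ _ => by omega)
    (fun k _ => h.sum_dying_le hw (by omega))
    (fun k _ => hw.dying_le (l + k) (by omega))
    (fun k _ i _ => Finset.disjoint_filter.2 fun q _ _ _ => by omega)

theorem hasMomentLE_mean_mul_sub (h : CellModel P ξ w p V C) (hw : GridBounds w n V δ)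
    (hp : 2 ≤ p) (hC : 0 ≤ C) (hn : 0 < n) (hl : l ≤ n) :
    HasMomentLE P p ((1 + 2 ^ (2 * p)) / 2 * ((1 + C) * V)) fun ω =>
      (1 / (n : ℝ) * ∑ k ∈ Finset.range n, cellSum ξ (aliveCells n k) ω) *
        (cellSum ξ (aliveCells n n) ω - cellSum ξ (aliveCells n l) ω) := by
  have hp' : 1 ≤ 2 * p := by linarith
  have halive (k) (hk : k ≤ n) := h.hasMomentLE_cellSum_of_le hC (by linarith) le_rfl
    (hw.alive_le k hk) (hw.alive_le k hk)
  have hmean := HasMomentLE.average hp' hn fun k hk => halive k hk.le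
  exact (hmean.mul (by linarith) ((halive n le_rfl).sub hp' (halive l hl))).mono (by linarith)

theorem hasMomentLE_laggedSum (h : CellModel P ξ w p V C) (hw : GridBounds w n V δ)
    (hp : 2 ≤ p) (hC : 0 ≤ C) (hδ : 0 < δ) (hn : 0 < n) (hl : l ≤ n) :
    HasMomentLE P p (laggedConst p V C * (1 + n * δ + (n * δ) ^ (p / 2))) fun ω =>
      laggedSum n l (fun k => cellSum ξ (aliveCells n k) ω) +
        ∑ k ∈ Finset.Ico l n, ∑ q ∈ dyingCells n (k - l) k, w q := by
  have hV := h.bound_nonneg hw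
  have hbilinear := bilinearConst_nonneg hp hV hC
  have hmean : 0 ≤ (1 + 2 ^ (2 * p)) / 2 * ((1 + C) * V) := by positivity
  have hH : 0 ≤ n * δ + (n * δ) ^ (p / 2) := by positivity
  set B := (bilinearConst p V C + (1 + 2 ^ (2 * p)) / 2 * ((1 + C) * V)) *
    (1 + n * δ + (n * δ) ^ (p / 2)) with hB
  have hbilinear_le : bilinearConst p V C * (n * δ + (n * δ) ^ (p / 2)) ≤ B := by nlinarith
  have hmean_le : (1 + 2 ^ (2 * p)) / 2 * ((1 + C) * V) ≤ B := by nlinarith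
  have h₁ := (h.hasMomentLE_alive_born hw hp hC hδ hn l).mono hbilinear_le
  have h₂ := (h.hasMomentLE_early_dying hw hp hC hδ hn l).mono hbilinear_le
  have h₃ := (h.hasMomentLE_surviving_dying hw hp hC hδ hn l).mono hbilinear_le
  have h₄ := (h.hasMomentLE_centered_dying_dying hw hp hC hδ hn l).mono hbilinear_le
  have h₅ := (h.hasMomentLE_mean_mul_sub hw hp hC hn hl).mono hmean_le
  simp_rw [laggedSum_alive_add_eq ξ w hl]
  exact (h₁.sub_four (by linarith) h₂ h₃ h₄ h₅).mono (by rw [hB, laggedConst, mul_assoc])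

end CellModel

end Grid

/-! ### The cells of a Lévy basis -/

section CellSet

variable {α : Type*}

/-- The points that belong to `A k`, `k ≤ n`, exactly for `i ≤ k ≤ j`, where `q = (i, j)`. -/
def cellSet (A : ℕ → Set α) (n : ℕ) (q : ℕ × ℕ) : Set α :=
  {x | q.1 ≤ q.2 ∧ q.2 ≤ n ∧ ∀ k ≤ n, (x ∈ A k ↔ q.1 ≤ k ∧ k ≤ q.2)}

theorem pairwise_disjoint_cellSet (A : ℕ → Set α) (n : ℕ) :
    Pairwise fun q q' => Disjoint (cellSet A n q) (cellSet A n q') := by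
  intro q q' hne
  rw [Set.disjoint_left]
  rintro x ⟨hq, hqn, hx⟩ ⟨hq', hqn', hx'⟩
  have birth_ge := (hx' q.1 (by omega)).1 ((hx q.1 (by omega)).2 ⟨le_rfl, hq⟩)
  have death_le := (hx' q.2 (by omega)).1 ((hx q.2 (by omega)).2 ⟨hq, le_rfl⟩)
  have birth_le := (hx q'.1 (by omega)).1 ((hx' q'.1 (by omega)).2 ⟨le_rfl, hq'⟩)
  have death_ge := (hx q'.2 (by omega)).1 ((hx' q'.2 (by omega)).2 ⟨hq', le_rfl⟩)
  exact hne (Prod.ext (by omega) (by omega))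

theorem cellSet_subset (A : ℕ → Set α) (n : ℕ) (q : ℕ × ℕ) : cellSet A n q ⊆ A q.1 :=
  fun _ hx => (hx.2.2 q.1 (hx.1.trans hx.2.1)).2 ⟨le_rfl, hx.1⟩

theorem biUnion_born_subset (A : ℕ → Set α) {n k : ℕ} (hk : k < n) :
    ⋃ q ∈ bornCells n (k + 1), cellSet A n q ⊆ A (k + 1) \ A k := by
  intro x
  simp only [mem_iUnion, exists_prop, bornCells, Finset.mem_filter]
  rintro ⟨q, ⟨-, hq⟩, -, -, hx⟩
  refine ⟨(hx (k + 1) hk).2 (by omega), fun hxk => ?_⟩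
  have := (hx k hk.le).1 hxk
  omega

end CellSet

/-- A sequence of bounded Borel sets in which, up to time `n`, no point returns after having
left. -/
structure IsInterlaced (A : ℕ → Set (ℝ × ℝ)) (n : ℕ) : Prop where
  measurableSet : ∀ k, MeasurableSet (A k)
  isBounded : ∀ k, Bornology.IsBounded (A k)
  mem_of_mem : ∀ i k j, i ≤ k → k ≤ j → j ≤ n → ∀ x, x ∈ A i → x ∈ A j → x ∈ A k

/-- Up to time `n`, the sets `A k` have area at most `V`, and in one step they gain and lose area
at most `δ`. -/
structure HasAreaBounds (A : ℕ → Set (ℝ × ℝ)) (n : ℕ) (V δ : ℝ) : Prop where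
  area_le : ∀ k ≤ n, volume.real (A k) ≤ V
  gain_le : ∀ k < n, volume.real (A (k + 1) \ A k) ≤ δ
  loss_le : ∀ k < n, volume.real (A k \ A (k + 1)) ≤ δ

/-- The total area of the points that leave at a time in `[l, n)` after having been present for at
least `l` steps. For a centered Lévy basis of unit variance this is minus the expectation of
`laggedSum n l` up to the contribution of the sample mean. -/
noncomputable def lostArea (A : ℕ → Set (ℝ × ℝ)) (n l : ℕ) : ℝ :=
  ∑ k ∈ Finset.Ico l n, volume.real ((A (k - l) ∩ A k) \ A (k + 1))

namespace IsInterlaced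

variable {A : ℕ → Set (ℝ × ℝ)} {n k : ℕ} {V δ : ℝ}

theorem measurableSet_cellSet (hA : IsInterlaced A n) (q : ℕ × ℕ) :
    MeasurableSet (cellSet A n q) := by
  have hmem (k : ℕ) : Measurable fun x => x ∈ A k := (hA.measurableSet k).mem
  simp only [cellSet, ofPred_and, ofPred_forall]
  exact (MeasurableSet.const _).inter ((MeasurableSet.const _).inter
    (MeasurableSet.iInter fun k => MeasurableSet.iInter fun _ =>
      measurableSet_setOfPred.2 ((hmem k).iff measurable_const)))

theorem isBounded_cellSet (hA : IsInterlaced A n) (q : ℕ × ℕ) :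
    Bornology.IsBounded (cellSet A n q) :=
  (hA.isBounded q.1).subset (cellSet_subset A n q)

theorem exists_mem_cellSet (hA : IsInterlaced A n) (hk : k ≤ n) {x : ℝ × ℝ} (hx : x ∈ A k) :
    ∃ q : ℕ × ℕ, q.1 ≤ k ∧ k ≤ q.2 ∧ q.2 ≤ n ∧ x ∈ cellSet A n q := by
  classical
  have hex : ∃ i, x ∈ A i := ⟨k, hx⟩
  set birth := Nat.find hex
  set death := Nat.findGreatest (fun i => x ∈ A i) n
  have birth_le : birth ≤ k := Nat.find_min' hex hx
  have le_death : k ≤ death := Nat.le_findGreatest hk hx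
  have death_le : death ≤ n := Nat.findGreatest_le n
  refine ⟨(birth, death), birth_le, le_death, death_le, birth_le.trans le_death, death_le,
    fun j hj => ⟨fun hxj => ⟨Nat.find_min' hex hxj, Nat.le_findGreatest hj hxj⟩, fun hbd => ?_⟩⟩
  exact hA.mem_of_mem birth j death hbd.1 hbd.2 death_le x (Nat.find_spec hex)
    (Nat.findGreatest_spec (P := fun i => x ∈ A i) hk hx)

theorem biUnion_alive (hA : IsInterlaced A n) (hk : k ≤ n) :
    ⋃ q ∈ aliveCells n k, cellSet A n q = A k := by
  ext x
  simp only [mem_iUnion, exists_prop, aliveCells, grid, Finset.mem_filter, Finset.mem_product,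
    Finset.mem_range]
  constructor
  · rintro ⟨q, ⟨-, hq⟩, hx⟩
    exact (hx.2.2 k hk).2 hq
  · intro hx
    obtain ⟨q, hqk, hkq, hqn, hxq⟩ := hA.exists_mem_cellSet hk hx
    exact ⟨q, ⟨⟨by omega, by omega⟩, hqk, hkq⟩, hxq⟩

theorem biUnion_dying (hA : IsInterlaced A n) {m : ℕ} (hm : m ≤ k) (hk : k < n) :
    ⋃ q ∈ dyingCells n m k, cellSet A n q = (A m ∩ A k) \ A (k + 1) := by
  ext x
  simp only [mem_iUnion, exists_prop, dyingCells, grid, Finset.mem_filter, Finset.mem_product,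
    Finset.mem_range]
  constructor
  · rintro ⟨q, ⟨-, hqm, hqk⟩, hq, -, hx⟩
    refine ⟨⟨(hx m (by omega)).2 (by omega), (hx k hk.le).2 (by omega)⟩, fun hx_succ => ?_⟩
    have := (hx (k + 1) hk).1 hx_succ
    omega
  · rintro ⟨⟨hxm, hxk⟩, hx_succ⟩
    obtain ⟨q, hqk, hkq, hqn, hxq⟩ := hA.exists_mem_cellSet hk.le hxk
    have hqm := (hxq.2.2 m (by omega)).1 hxm
    have hq_succ : ¬(q.1 ≤ k + 1 ∧ k + 1 ≤ q.2) := fun h => hx_succ ((hxq.2.2 (k + 1) hk).2 h)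
    exact ⟨q, ⟨⟨by omega, by omega⟩, by omega, by omega⟩, hxq⟩

theorem sum_volume_cellSet (hA : IsInterlaced A n) (S : Finset (ℕ × ℕ)) :
    ∑ q ∈ S, volume.real (cellSet A n q) = volume.real (⋃ q ∈ S, cellSet A n q) :=
  (measureReal_biUnion_finset (fun _ _ _ _ hne => pairwise_disjoint_cellSet A n hne)
    (fun q _ => hA.measurableSet_cellSet q)
    fun q _ => (hA.isBounded_cellSet q).measure_lt_top.ne).symm

theorem gridBounds_cellSet (hA : IsInterlaced A n) (hvol : HasAreaBounds A n V δ) :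
    GridBounds (fun q => volume.real (cellSet A n q)) n V δ where
  alive_le k hk := by
    rw [hA.sum_volume_cellSet, hA.biUnion_alive hk]
    exact hvol.area_le k hk
  born_le k hk := by
    rw [hA.sum_volume_cellSet]
    exact (measureReal_mono (biUnion_born_subset A hk)
      ((hA.isBounded _).subset sdiff_subset).measure_lt_top.ne).trans (hvol.gain_le k hk)
  dying_le k hk := by
    rw [hA.sum_volume_cellSet, hA.biUnion_dying le_rfl hk, inter_self]
    exact hvol.loss_le k hk

theorem sum_volume_dying (hA : IsInterlaced A n) (l : ℕ) :
    ∑ k ∈ Finset.Ico l n, ∑ q ∈ dyingCells n (k - l) k, volume.real (cellSet A n q) =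
      lostArea A n l := by
  refine Finset.sum_congr rfl fun k hk => ?_
  rw [hA.sum_volume_cellSet, hA.biUnion_dying (Nat.sub_le k l) (Finset.mem_Ico.1 hk).2]

end IsInterlaced

theorem laggedSum_congr {n l : ℕ} {x y : ℕ → ℝ} (h : ∀ k ≤ n, x k = y k) :
    laggedSum n l x = laggedSum n l y := by
  unfold laggedSum
  rw [Finset.sum_congr rfl fun k hk => h k (Finset.mem_range.1 hk).le]
  refine Finset.sum_congr rfl fun k hk => ?_
  have := (Finset.mem_Ico.1 hk).2
  rw [h (k - l) (by omega), h (k + 1) (by omega), h k (by omega)]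

namespace IsLevyBasis

variable {Ω : Type*} [MeasurableSpace Ω] {P : Measure Ω} {γ b : ℝ} {ν : Measure ℝ}
  {L : Set (ℝ × ℝ) → Ω → ℝ} {m p V : ℝ}

theorem cellSum_cellSet_ae_eq (hL : IsLevyBasis P γ b ν L) (m : ℝ) {A : ℕ → Set (ℝ × ℝ)} {n : ℕ}
    (hA : IsInterlaced A n) (S : Finset (ℕ × ℕ)) :
    cellSum (fun q => centered L m (cellSet A n q)) S =ᵐ[P]
      centered L m (⋃ q ∈ S, cellSet A n q) :=
  (hL.centered_biUnion_ae_eq m hA.measurableSet_cellSet hA.isBounded_cellSet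
    (pairwise_disjoint_cellSet A n) S).symm

theorem exists_cellModel (hL : IsLevyBasis P γ b ν L) (hm : HasMoments P L m (2 * p)) (V : ℝ) :
    ∃ C, 0 ≤ C ∧ ∀ n A, IsInterlaced A n →
      CellModel P (fun q => centered L m (cellSet A n q))
        (fun q => volume.real (cellSet A n q)) p V C := by
  obtain ⟨C, hC, hmoment⟩ := hm.moment_le V
  refine ⟨C, hC, fun n A hA => ?_⟩
  have hcell := hA.measurableSet_cellSet
  have hcell_bdd := hA.isBounded_cellSet
  have hunion (S : Finset (ℕ × ℕ)) := S.measurableSet_biUnion fun q _ => hcell q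
  have hunion_bdd (S : Finset (ℕ × ℕ)) :=
    (Bornology.isBounded_biUnion_finset S).2 fun q _ => hcell_bdd q
  exact {
    measurable := fun q => hL.measurable_centered m (hcell q) (hcell_bdd q)
    indep := hL.iIndepFun_centered m hcell hcell_bdd (pairwise_disjoint_cellSet A n)
    weight_nonneg := fun q => measureReal_nonneg
    memLp := fun q => hm.memLp _ (hcell q) (hcell_bdd q)
    mean := fun q => hm.mean _ (hcell q) (hcell_bdd q)
    sq := fun S => by
      rw [hA.sum_volume_cellSet, ← hm.sq _ (hunion S) (hunion_bdd S)]
      exact integral_congr_ae ((hL.cellSum_cellSet_ae_eq m hA S).fun_comp (· ^ 2))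
    moment_le := fun S hS => by
      rw [hA.sum_volume_cellSet] at hS ⊢
      exact (integral_congr_ae
        ((hL.cellSum_cellSet_ae_eq m hA S).fun_comp (|·| ^ (2 * p)))).trans_le
          (hmoment _ (hunion S) (hunion_bdd S) hS) }

theorem exists_hasMomentLE_laggedSum [IsProbabilityMeasure P] (hL : IsLevyBasis P γ b ν L)
    (hm : HasMoments P L m (2 * p)) (hp : 2 ≤ p) (hV : 0 ≤ V) :
    ∃ D, 0 ≤ D ∧ ∀ (n l : ℕ) (A : ℕ → Set (ℝ × ℝ)) (δ : ℝ), 0 < n → l ≤ n → 0 < δ →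
      IsInterlaced A n → HasAreaBounds A n V δ →
      HasMomentLE P p (D * (1 + n * δ + (n * δ) ^ (p / 2))) fun ω =>
        laggedSum n l (fun k => centered L m (A k) ω) + lostArea A n l := by
  obtain ⟨C, hC, hmodel⟩ := hL.exists_cellModel hm V
  refine ⟨laggedConst p V C, laggedConst_nonneg hp hV hC, fun n l A δ hn hl hδ hA hvol => ?_⟩
  have hbound := (hmodel n A hA).hasMomentLE_laggedSum (hA.gridBounds_cellSet hvol) hp hC hδ hn hl
  simp only [hA.sum_volume_dying] at hbound
  have hcells : ∀ᵐ ω ∂P, ∀ k ≤ n,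
      cellSum (fun q => centered L m (cellSet A n q)) (aliveCells n k) ω =
        centered L m (A k) ω := by
    refine ae_all_iff.2 fun k => ae_all_iff.2 fun hk => ?_
    have hcells_k := hL.cellSum_cellSet_ae_eq m hA (aliveCells n k)
    rwa [hA.biUnion_alive hk] at hcells_k
  refine hbound.congr_ae ?_
  filter_upwards [hcells] with ω hω
  rw [laggedSum_congr hω]

end IsLevyBasis

/-! ### Geometry of trawl sets -/

theorem mem_trawlSetAt {a : ℝ → ℝ} {t : ℝ} {x : ℝ × ℝ} :
    x ∈ trawlSetAt a t ↔ x.1 ≤ t ∧ 0 ≤ x.2 ∧ x.2 ≤ a (t - x.1) := by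
  simp [trawlSetAt, trawlSet, image_add_right, ← sub_eq_add_neg]

namespace IsTrawlFunction

variable {a : ℝ → ℝ} {s t u x y : ℝ}

theorem measurableSet_trawlSetAt (ha : IsTrawlFunction a) (t : ℝ) :
    MeasurableSet (trawlSetAt a t) := by
  have hset : trawlSetAt a t =
      {x : ℝ × ℝ | 0 ≤ x.2} ∩ {x ∈ {x : ℝ × ℝ | x.1 ≤ t} | x.2 ≤ a (t - x.1)} := by
    ext x
    simp only [mem_trawlSetAt, mem_inter_iff, mem_ofPred_eq]
    tauto
  have hcont : ContinuousOn (fun x : ℝ × ℝ => a (t - x.1)) {x | x.1 ≤ t} :=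
    ha.continuous.comp (by fun_prop) fun x hx => mem_Ici.2 (sub_nonneg.2 hx)
  rw [hset]
  exact ((isClosed_le (by fun_prop) (by fun_prop)).inter
    ((isClosed_le (by fun_prop) (by fun_prop)).isClosed_le (by fun_prop) hcont)).measurableSet

theorem mem_of_mem (ha : IsTrawlFunction a) (hst : s ≤ t) (htu : t ≤ u) {x : ℝ × ℝ}
    (hs : x ∈ trawlSetAt a s) (hu : x ∈ trawlSetAt a u) : x ∈ trawlSetAt a t := by
  rw [mem_trawlSetAt] at hs hu ⊢
  have hxt := hs.1.trans hst
  exact ⟨hxt, hs.2.1, hu.2.2.trans (ha.antitone (sub_nonneg.2 hxt)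
    (sub_nonneg.2 (hxt.trans htu)) (by gcongr))⟩

theorem volume_slice_inter (ha : IsTrawlFunction a) (hst : s ≤ t) (r : ℝ) :
    volume (Prod.mk r ⁻¹' (trawlSetAt a s ∩ trawlSetAt a t)) =
      (Ici (t - s)).indicator (fun u => ENNReal.ofReal (a u)) (t - r) := by
  by_cases hr : r ≤ s
  · have hslice : Prod.mk r ⁻¹' (trawlSetAt a s ∩ trawlSetAt a t) = Icc 0 (a (t - r)) := by
      have hle : a (t - r) ≤ a (s - r) :=
        ha.antitone (sub_nonneg.2 hr) (sub_nonneg.2 (hr.trans hst)) (by gcongr)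
      ext y
      simp only [mem_preimage, mem_inter_iff, mem_trawlSetAt, mem_Icc]
      exact ⟨fun h => h.2.2, fun h => ⟨⟨hr, h.1, h.2.trans hle⟩, hr.trans hst, h⟩⟩
    rw [hslice, indicator_of_mem (mem_Ici.2 (by gcongr)), Real.volume_Icc, sub_zero]
  · have hslice : Prod.mk r ⁻¹' (trawlSetAt a s ∩ trawlSetAt a t) = ∅ :=
      eq_empty_of_forall_notMem fun y hy => hr (mem_trawlSetAt.1 hy.1).1
    rw [hslice, indicator_of_notMem fun h => hr ((sub_le_sub_iff_left t).1 (mem_Ici.1 h)),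
      measure_empty]

theorem volume_inter (ha : IsTrawlFunction a) (hst : s ≤ t) :
    volume (trawlSetAt a s ∩ trawlSetAt a t) = ∫⁻ u in Ici (t - s), ENNReal.ofReal (a u) := by
  rw [Measure.volume_eq_prod, Measure.prod_apply
    ((ha.measurableSet_trawlSetAt s).inter (ha.measurableSet_trawlSetAt t))]
  simp_rw [ha.volume_slice_inter hst]
  rw [lintegral_sub_left_eq_self (fun u => (Ici (t - s)).indicator
    (fun u => ENNReal.ofReal (a u)) u) t, lintegral_indicator measurableSet_Ici]

theorem lintegral_Ici_ne_top (ha : IsTrawlFunction a) (hx : 0 ≤ x) :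
    ∫⁻ u in Ici x, ENNReal.ofReal (a u) ≠ ∞ :=
  (ha.integrable.mono_set (Ici_subset_Ici.2 hx)).lintegral_lt_top.ne

theorem volume_trawlSetAt (ha : IsTrawlFunction a) (t : ℝ) :
    volume (trawlSetAt a t) = ∫⁻ u in Ici 0, ENNReal.ofReal (a u) := by
  have hvol := ha.volume_inter (le_refl t)
  rwa [inter_self, sub_self] at hvol

theorem volume_ne_top (ha : IsTrawlFunction a) (t : ℝ) : volume (trawlSetAt a t) ≠ ∞ := by
  rw [ha.volume_trawlSetAt]
  exact ha.lintegral_Ici_ne_top le_rfl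

theorem volume_real_trawlSetAt (ha : IsTrawlFunction a) (s t : ℝ) :
    volume.real (trawlSetAt a s) = volume.real (trawlSetAt a t) := by
  rw [measureReal_def, measureReal_def, ha.volume_trawlSetAt s, ha.volume_trawlSetAt t]

theorem apply_zero_pos (ha : IsTrawlFunction a) : 0 < a 0 := by
  by_contra! hle
  have hset : trawlSetAt a 0 = trawlSet a := by
    ext x
    simp [mem_trawlSetAt, trawlSet]
  refine ha.nontrivial.ne' ?_
  rw [← hset, ha.volume_trawlSetAt, setLIntegral_congr_fun measurableSet_Ici
    (g := fun _ => 0) fun u hu => ENNReal.ofReal_of_nonpos ?_, lintegral_zero]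
  exact (ha.antitone self_mem_Ici hu hu).trans hle

theorem volume_inter_sdiff (ha : IsTrawlFunction a) (hus : u ≤ s) (hst : s ≤ t) :
    volume ((trawlSetAt a u ∩ trawlSetAt a s) \ trawlSetAt a t) =
      ∫⁻ r in Ico (s - u) (t - u), ENNReal.ofReal (a r) := by
  have hsub : trawlSetAt a u ∩ trawlSetAt a t ⊆ trawlSetAt a u ∩ trawlSetAt a s := fun x hx =>
    ⟨hx.1, ha.mem_of_mem hus hst hx.1 hx.2⟩
  have hset : (trawlSetAt a u ∩ trawlSetAt a s) \ trawlSetAt a t =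
      (trawlSetAt a u ∩ trawlSetAt a s) \ (trawlSetAt a u ∩ trawlSetAt a t) := by
    ext x
    simp only [Set.mem_sdiff, mem_inter_iff]
    tauto
  have htail_fin := ha.lintegral_Ici_ne_top (sub_nonneg.2 (hus.trans hst))
  have hdisj : Disjoint (Ico (s - u) (t - u)) (Ici (t - u)) :=
    disjoint_left.2 fun r hr hr' => hr.2.not_ge hr'
  have htail : ∫⁻ r in Ici (s - u), ENNReal.ofReal (a r) =
      (∫⁻ r in Ico (s - u) (t - u), ENNReal.ofReal (a r)) +
        ∫⁻ r in Ici (t - u), ENNReal.ofReal (a r) := by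
    rw [← lintegral_union measurableSet_Ici hdisj,
      Ico_union_Ici_eq_Ici (by gcongr)]
  have hinter_meas := (ha.measurableSet_trawlSetAt u).inter (ha.measurableSet_trawlSetAt t)
  rw [hset, measure_sdiff hsub hinter_meas.nullMeasurableSet
    (by rwa [ha.volume_inter (hus.trans hst)]), ha.volume_inter hus,
    ha.volume_inter (hus.trans hst), htail]
  exact ENNReal.add_sub_cancel_right htail_fin

theorem volume_real_inter_sdiff_le (ha : IsTrawlFunction a) (hus : u ≤ s) (hst : s ≤ t) :
    volume.real ((trawlSetAt a u ∩ trawlSetAt a s) \ trawlSetAt a t) ≤ a (s - u) * (t - s) := by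
  have hsu := sub_nonneg.2 hus
  have hnonneg := ha.nonneg _ hsu
  refine ENNReal.toReal_le_of_le_ofReal (mul_nonneg hnonneg (sub_nonneg.2 hst)) ?_
  calc volume ((trawlSetAt a u ∩ trawlSetAt a s) \ trawlSetAt a t)
      = ∫⁻ r in Ico (s - u) (t - u), ENNReal.ofReal (a r) := ha.volume_inter_sdiff hus hst
    _ ≤ ∫⁻ _ in Ico (s - u) (t - u), ENNReal.ofReal (a (s - u)) :=
        setLIntegral_mono' measurableSet_Ico fun r hr =>
          ENNReal.ofReal_le_ofReal (ha.antitone hsu (hsu.trans hr.1) hr.1)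
    _ = ENNReal.ofReal (a (s - u) * (t - s)) := by
        rw [setLIntegral_const, Real.volume_Ico, sub_sub_sub_cancel_right,
          ENNReal.ofReal_mul hnonneg]

theorem le_volume_real_inter_sdiff (ha : IsTrawlFunction a) (hus : u ≤ s) (hst : s ≤ t) :
    a (t - u) * (t - s) ≤ volume.real ((trawlSetAt a u ∩ trawlSetAt a s) \ trawlSetAt a t) := by
  have hsu := sub_nonneg.2 hus
  have htu := sub_nonneg.2 (hus.trans hst)
  have hfin : volume ((trawlSetAt a u ∩ trawlSetAt a s) \ trawlSetAt a t) ≠ ∞ :=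
    measure_ne_top_of_subset (sdiff_subset.trans inter_subset_left) (ha.volume_ne_top u)
  rw [measureReal_def, ← ENNReal.ofReal_le_iff_le_toReal hfin]
  calc ENNReal.ofReal (a (t - u) * (t - s))
      = ∫⁻ _ in Ico (s - u) (t - u), ENNReal.ofReal (a (t - u)) := by
        rw [setLIntegral_const, Real.volume_Ico, sub_sub_sub_cancel_right,
          ENNReal.ofReal_mul (ha.nonneg _ htu)]
    _ ≤ ∫⁻ r in Ico (s - u) (t - u), ENNReal.ofReal (a r) :=
        setLIntegral_mono' measurableSet_Ico fun r hr =>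
          ENNReal.ofReal_le_ofReal (ha.antitone (hsu.trans hr.1) htu hr.2.le)
    _ = volume ((trawlSetAt a u ∩ trawlSetAt a s) \ trawlSetAt a t) :=
        (ha.volume_inter_sdiff hus hst).symm

theorem volume_real_sdiff_le (ha : IsTrawlFunction a) (hst : s ≤ t) :
    volume.real (trawlSetAt a s \ trawlSetAt a t) ≤ a 0 * (t - s) := by
  have hle := ha.volume_real_inter_sdiff_le (le_refl s) hst
  rwa [inter_self, sub_self] at hle

theorem volume_real_sdiff_comm (ha : IsTrawlFunction a) (s t : ℝ) :
    volume.real (trawlSetAt a t \ trawlSetAt a s) =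
      volume.real (trawlSetAt a s \ trawlSetAt a t) := by
  have ht := measureReal_inter_add_sdiff (μ := volume) (ha.measurableSet_trawlSetAt s)
    (ha.volume_ne_top t)
  have hs := measureReal_inter_add_sdiff (μ := volume) (ha.measurableSet_trawlSetAt t)
    (ha.volume_ne_top s)
  rw [inter_comm] at hs
  linarith [ha.volume_real_trawlSetAt s t]

theorem hasAreaBounds (ha : IsTrawlFunction a) {Δ : ℝ} (hΔ : 0 ≤ Δ) (n : ℕ) :
    HasAreaBounds (fun k => trawlSetAt a (k * Δ)) n (volume.real (trawlSetAt a 0)) (a 0 * Δ) := by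
  have hstep (k : ℕ) : volume.real (trawlSetAt a (k * Δ) \ trawlSetAt a ((k + 1 : ℕ) * Δ)) ≤
      a 0 * Δ := by
    have hle := ha.volume_real_sdiff_le (s := k * Δ) (t := (k + 1 : ℕ) * Δ) (by gcongr; simp)
    rwa [← sub_mul, ← Nat.cast_sub k.le_succ, Nat.succ_sub (le_refl k), Nat.sub_self, Nat.cast_one,
      one_mul] at hle
  exact {
    area_le := fun k _ => (ha.volume_real_trawlSetAt _ _).le
    gain_le := fun k _ => (ha.volume_real_sdiff_comm _ _).trans_le (hstep k)
    loss_le := fun k _ => hstep k }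

end IsTrawlFunction

section Truncation

variable {A : ℕ → Set (ℝ × ℝ)} {B : Set (ℝ × ℝ)}

theorem HasAreaBounds.inter {n : ℕ} {V δ : ℝ} (h : HasAreaBounds A n V δ)
    (hA : ∀ k, volume (A k) ≠ ∞) (B : Set (ℝ × ℝ)) : HasAreaBounds (fun k => A k ∩ B) n V δ := by
  have hsdiff (i j : ℕ) : volume.real ((A i ∩ B) \ (A j ∩ B)) ≤ volume.real (A i \ A j) :=
    measureReal_mono (fun x hx => ⟨hx.1.1, fun hxj => hx.2 ⟨hxj, hx.1.2⟩⟩)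
      (measure_ne_top_of_subset sdiff_subset (hA i))
  exact {
    area_le := fun k hk => (measureReal_mono inter_subset_left (hA k)).trans (h.area_le k hk)
    gain_le := fun k hk => (hsdiff _ _).trans (h.gain_le k hk)
    loss_le := fun k hk => (hsdiff _ _).trans (h.loss_le k hk) }

/-- The square `[-K, K]²`. -/
def box (K : ℕ) : Set (ℝ × ℝ) := Icc (-(K : ℝ)) K ×ˢ Icc (-(K : ℝ)) K

theorem measurableSet_box (K : ℕ) : MeasurableSet (box K) :=
  measurableSet_Icc.prod measurableSet_Icc

theorem isBounded_box (K : ℕ) : Bornology.IsBounded (box K) :=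
  (Metric.isBounded_Icc _ _).prod (Metric.isBounded_Icc _ _)

theorem monotone_box : Monotone box := fun K K' hK => by
  have hcast : (K : ℝ) ≤ K' := by exact_mod_cast hK
  exact prod_mono (Icc_subset_Icc (neg_le_neg hcast) hcast)
    (Icc_subset_Icc (neg_le_neg hcast) hcast)

theorem iUnion_box : ⋃ K, box K = univ := by
  refine eq_univ_of_forall fun x => ?_
  obtain ⟨K, hK⟩ := exists_nat_ge (max |x.1| |x.2|)
  exact mem_iUnion.2 ⟨K, abs_le.1 ((le_max_left _ _).trans hK),
    abs_le.1 ((le_max_right _ _).trans hK)⟩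

theorem tendsto_volume_inter_box (hB : volume B ≠ ∞) :
    Tendsto (fun K => volume.real (B ∩ box K)) atTop (𝓝 (volume.real B)) := by
  have hmono : Monotone fun K => B ∩ box K := fun _ _ hK =>
    inter_subset_inter_right B (monotone_box hK)
  have hlim := tendsto_measure_iUnion_atTop (μ := volume) hmono
  rw [← inter_iUnion, iUnion_box, inter_univ] at hlim
  exact (ENNReal.tendsto_toReal hB).comp hlim

theorem tendsto_lostArea_inter_box (hA : ∀ k, volume (A k) ≠ ∞) (n l : ℕ) :
    Tendsto (fun K => lostArea (fun k => A k ∩ box K) n l) atTop (𝓝 (lostArea A n l)) := by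
  refine tendsto_finsetSum _ fun k _ => ?_
  have hset (K : ℕ) : ((A (k - l) ∩ box K) ∩ (A k ∩ box K)) \ (A (k + 1) ∩ box K) =
      ((A (k - l) ∩ A k) \ A (k + 1)) ∩ box K := by
    ext x
    simp only [Set.mem_sdiff, mem_inter_iff]
    tauto
  simp_rw [hset]
  exact tendsto_volume_inter_box
    (measure_ne_top_of_subset (sdiff_subset.trans inter_subset_right) (hA k))

theorem IsTrawlFunction.isInterlaced_inter_box {a : ℝ → ℝ} (ha : IsTrawlFunction a) {Δ : ℝ}
    (hΔ : 0 ≤ Δ) (n K : ℕ) : IsInterlaced (fun k => trawlSetAt a (k * Δ) ∩ box K) n where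
  measurableSet k := (ha.measurableSet_trawlSetAt _).inter (measurableSet_box K)
  isBounded k := (isBounded_box K).subset inter_subset_right
  mem_of_mem i k j hik hkj _ x hi hj := ⟨ha.mem_of_mem (by gcongr) (by gcongr) hi.1 hj.1, hi.2⟩

end Truncation

/-! ### Removal of the truncation -/

theorem exists_common_subseq {α : Type*} [MeasurableSpace α] {μ : Measure α}
    {f : ℕ → ℕ → α → ℝ} {g : ℕ → α → ℝ} (h : ∀ k, TendstoInMeasure μ (f k) atTop (g k)) (N : ℕ) :
    ∃ ns : ℕ → ℕ, StrictMono ns ∧ ∀ᵐ x ∂μ, ∀ k < N,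
      Tendsto (fun i => f k (ns i) x) atTop (𝓝 (g k x)) := by
  induction N with
  | zero => exact ⟨id, strictMono_id, ae_of_all _ fun x k hk => absurd hk k.not_lt_zero⟩
  | succ N ih =>
    obtain ⟨ns, hns, hlim⟩ := ih
    obtain ⟨ms, hms, hlim_N⟩ := ((h N).comp hns.tendsto_atTop).exists_seq_tendsto_ae
    refine ⟨ns ∘ ms, hns.comp hms, ?_⟩
    filter_upwards [hlim, hlim_N] with x hx hx_N k hk
    rcases Nat.lt_succ_iff_lt_or_eq.1 hk with hk | rfl
    · exact (hx k hk).comp hms.tendsto_atTop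
    · exact hx_N

theorem tendsto_laggedSum {n l : ℕ} {x : ℕ → ℕ → ℝ} {y : ℕ → ℝ}
    (h : ∀ k ≤ n, Tendsto (fun i => x i k) atTop (𝓝 (y k))) :
    Tendsto (fun i => laggedSum n l (x i)) atTop (𝓝 (laggedSum n l y)) := by
  have hmean : Tendsto (fun i => 1 / (n : ℝ) * ∑ k ∈ Finset.range n, x i k) atTop
      (𝓝 (1 / (n : ℝ) * ∑ k ∈ Finset.range n, y k)) :=
    (tendsto_finsetSum _ fun k hk => h k (Finset.mem_range.1 hk).le).const_mul _
  refine tendsto_finsetSum _ fun k hk => ?_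
  have hkn := (Finset.mem_Ico.1 hk).2
  exact ((h (k - l) (by omega)).sub hmean).mul ((h (k + 1) hkn).sub (h k hkn.le))

theorem laggedSum_sub_const {n : ℕ} (hn : 0 < n) (l : ℕ) (x : ℕ → ℝ) (c : ℝ) :
    laggedSum n l (fun k => x k - c) = laggedSum n l x := by
  have hn' : (n : ℝ) ≠ 0 := by positivity
  have hmean : 1 / (n : ℝ) * ∑ k ∈ Finset.range n, (x k - c) =
      1 / (n : ℝ) * ∑ k ∈ Finset.range n, x k - c := by
    rw [Finset.sum_sub_distrib, Finset.sum_const, Finset.card_range, nsmul_eq_mul]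
    field_simp
  simp only [laggedSum, hmean, sub_sub_sub_cancel_right]

namespace IsTrawlProcess

variable {Ω : Type*} [MeasurableSpace Ω] {P : Measure Ω} {γ b : ℝ} {ν : Measure ℝ}
  {L : Set (ℝ × ℝ) → Ω → ℝ} {m p : ℝ} {a : ℝ → ℝ} {X : ℝ → Ω → ℝ}

theorem exists_subseq_tendsto_laggedSum (hX : IsTrawlProcess P L a X) (ha : IsTrawlFunction a)
    (m Δ : ℝ) {n : ℕ} (hn : 0 < n) (l : ℕ) :
    ∃ ns : ℕ → ℕ, Tendsto ns atTop atTop ∧ ∀ᵐ ω ∂P, Tendsto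
      (fun i => laggedSum n l fun k => centered L m (trawlSetAt a (k * Δ) ∩ box (ns i)) ω) atTop
      (𝓝 (laggedSum n l fun k => X (k * Δ) ω)) := by
  obtain ⟨ns, hns, hlim⟩ := exists_common_subseq (fun k : ℕ => hX (k * Δ)) (n + 1)
  refine ⟨ns, hns.tendsto_atTop, ?_⟩
  filter_upwards [hlim] with ω hω
  rw [← laggedSum_sub_const hn l (fun k => X (k * Δ) ω) (m * volume.real (trawlSetAt a 0))]
  refine tendsto_laggedSum fun k hk => (hω k (Nat.lt_succ_of_le hk)).sub ?_
  have hvol := (tendsto_volume_inter_box (ha.volume_ne_top (k * Δ))).comp hns.tendsto_atTop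
  rw [ha.volume_real_trawlSetAt _ 0] at hvol
  exact hvol.const_mul m

theorem exists_hasMomentLE_laggedSum [IsProbabilityMeasure P] (hX : IsTrawlProcess P L a X)
    (hL : IsLevyBasis P γ b ν L) (hm : HasMoments P L m (2 * p)) (hp : 2 ≤ p)
    (ha : IsTrawlFunction a) :
    ∃ D, 0 ≤ D ∧ ∀ (n l : ℕ) (Δ : ℝ), 0 < n → l ≤ n → 0 < Δ →
      HasMomentLE P p (D * (1 + n * (a 0 * Δ) + (n * (a 0 * Δ)) ^ (p / 2))) fun ω =>
        laggedSum n l (fun k => X (k * Δ) ω) + lostArea (fun k => trawlSetAt a (k * Δ)) n l := by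
  obtain ⟨D, hD, hbound⟩ := hL.exists_hasMomentLE_laggedSum hm hp
    (measureReal_nonneg (μ := volume) (s := trawlSetAt a 0))
  refine ⟨D, hD, fun n l Δ hn hl hΔ => ?_⟩
  obtain ⟨ns, hns, hlim⟩ := hX.exists_subseq_tendsto_laggedSum ha m Δ hn l
  have hfin (k : ℕ) := ha.volume_ne_top (k * Δ)
  refine HasMomentLE.of_tendsto_ae (by linarith)
    (fun i => hbound n l (fun k => trawlSetAt a (k * Δ) ∩ box (ns i)) _ hn hl
      (mul_pos ha.apply_zero_pos hΔ) (ha.isInterlaced_inter_box hΔ.le n (ns i))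
      ((ha.hasAreaBounds hΔ.le n).inter hfin _)) ?_
  filter_upwards [hlim] with ω hω
  exact hω.add ((tendsto_lostArea_inter_box hfin n l).comp hns)

end IsTrawlProcess

/-! ### Riemann sums -/

section Riemann

variable {h : ℝ → ℝ} {T t x ε δ : ℝ}

theorem floor_div_mul_le (ht : 0 ≤ t) (hδ : 0 < δ) : ⌊t / δ⌋₊ * δ ≤ t :=
  (le_div_iff₀ hδ).1 (Nat.floor_le (div_nonneg ht hδ.le))

theorem eventually_abs_sub_le_of_continuousOn (hh : ContinuousOn h (Icc 0 T)) (hε : 0 < ε) :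
    ∀ᶠ δ in 𝓝[>] 0, ∀ x ∈ Icc 0 T, ∀ y ∈ Icc 0 T, |x - y| ≤ δ → |h x - h y| ≤ ε := by
  obtain ⟨d, hd, hclose⟩ := Metric.uniformContinuousOn_iff.1
    (isCompact_Icc.uniformContinuousOn_of_continuous hh) ε hε
  filter_upwards [Ioo_mem_nhdsGT hd] with δ hδ x hx y hy hxy
  exact (hclose x hx y hy (hxy.trans_lt hδ.2)).le

theorem abs_mul_sub_integral_le (hδ : 0 ≤ δ) (hh : ContinuousOn h (Icc x (x + δ)))
    (hosc : ∀ s ∈ Icc x (x + δ), |h x - h s| ≤ ε) :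
    |δ * h x - ∫ s in x..(x + δ), h s| ≤ ε * δ := by
  have hle : x ≤ x + δ := by linarith
  have hint : IntervalIntegrable h volume x (x + δ) := hh.intervalIntegrable_of_Icc hle
  have hdiff : δ * h x - ∫ s in x..(x + δ), h s = ∫ s in x..(x + δ), (h x - h s) := by
    rw [intervalIntegral.integral_sub intervalIntegrable_const hint,
      intervalIntegral.integral_const, smul_eq_mul, add_sub_cancel_left]
  have hbound := intervalIntegral.norm_integral_le_of_norm_le_const (a := x) (b := x + δ)
    (f := fun s => h x - h s) (C := ε) fun s hs =>
      hosc s (Ioc_subset_Icc_self (by rwa [uIoc_of_le hle] at hs))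
  rwa [← hdiff, Real.norm_eq_abs, add_sub_cancel_left, abs_of_nonneg hδ] at hbound

theorem abs_riemannSum_sub_integral_le (hδ : 0 ≤ δ) {M : ℕ} (hM : M * δ ≤ T)
    (hh : ContinuousOn h (Icc 0 T))
    (hosc : ∀ x ∈ Icc 0 T, ∀ y ∈ Icc 0 T, |x - y| ≤ δ → |h x - h y| ≤ ε) :
    |δ * ∑ l ∈ Finset.range M, h (l * δ) - ∫ s in (0 : ℝ)..(M * δ), h s| ≤ ε * (M * δ) := by
  induction M with
  | zero => simp
  | succ M ih =>
    have hsucc : ((M + 1 : ℕ) : ℝ) * δ = M * δ + δ := by push_cast; ring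
    rw [hsucc] at hM ⊢
    have hMδ : 0 ≤ M * δ := by positivity
    have hcell : Icc (M * δ) (M * δ + δ) ⊆ Icc 0 T := Icc_subset_Icc hMδ hM
    have hlast : |δ * h (M * δ) - ∫ s in (M * δ)..(M * δ + δ), h s| ≤ ε * δ := by
      refine abs_mul_sub_integral_le hδ (hh.mono hcell) fun s hs => ?_
      refine hosc _ (hcell ⟨le_rfl, by linarith⟩) s (hcell hs) ?_
      rw [abs_sub_comm, abs_of_nonneg (by linarith [hs.1])]
      linarith [hs.2]
    have hfirst := ih (by linarith)
    have hsplit : ∫ s in (0 : ℝ)..(M * δ + δ), h s =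
        (∫ s in (0 : ℝ)..(M * δ), h s) + ∫ s in (M * δ)..(M * δ + δ), h s :=
      (intervalIntegral.integral_add_adjacent_intervals
        ((hh.mono (Icc_subset_Icc_right (by linarith))).intervalIntegrable_of_Icc hMδ)
        ((hh.mono hcell).intervalIntegrable_of_Icc (by linarith))).symm
    rw [Finset.sum_range_succ, hsplit, mul_add, mul_add, add_sub_add_comm]
    exact (abs_add_le _ _).trans (add_le_add hfirst hlast)

theorem eventually_abs_riemannSum_sub_integral_le (hT : 0 < T) (hh : ContinuousOn h (Icc 0 T))
    (hε : 0 < ε) :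
    ∀ᶠ δ in 𝓝[>] 0, ∀ t ∈ Icc 0 T,
      |δ * ∑ l ∈ Finset.range ⌊t / δ⌋₊, h (l * δ) - ∫ s in (0 : ℝ)..t, h s| ≤ ε := by
  obtain ⟨G, hG⟩ := isCompact_Icc.exists_bound_of_continuousOn hh
  have hG_nonneg : 0 ≤ G := (norm_nonneg _).trans (hG 0 ⟨le_rfl, hT.le⟩)
  filter_upwards [eventually_abs_sub_le_of_continuousOn hh (by positivity : 0 < ε / (2 * T)),
    Ioo_mem_nhdsGT (by positivity : 0 < ε / (2 * (G + 1)))] with δ hosc hδ t ht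
  set M := ⌊t / δ⌋₊
  have hδ_pos : 0 < δ := hδ.1
  have hMt : M * δ ≤ t := floor_div_mul_le ht.1 hδ_pos
  have htM : t ≤ M * δ + δ := by
    have hlt := (div_lt_iff₀ hδ_pos).1 (Nat.lt_floor_add_one (t / δ))
    linarith
  have hMδ : 0 ≤ M * δ := by positivity
  have hsum : |δ * ∑ l ∈ Finset.range M, h (l * δ) - ∫ s in (0 : ℝ)..(M * δ), h s| ≤ ε / 2 := by
    refine (abs_riemannSum_sub_integral_le hδ_pos.le (hMt.trans ht.2) hh hosc).trans ?_
    calc ε / (2 * T) * (M * δ) ≤ ε / (2 * T) * T := by gcongr; exact hMt.trans ht.2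
      _ = ε / 2 := by field_simp
  have hlast : |∫ s in (M * δ)..t, h s| ≤ ε / 2 := by
    calc |∫ s in (M * δ)..t, h s| ≤ G * |t - M * δ| :=
        intervalIntegral.norm_integral_le_of_norm_le_const (C := G) fun s hs => by
          rw [uIoc_of_le hMt] at hs
          exact hG s ⟨hMδ.trans hs.1.le, hs.2.trans ht.2⟩
      _ ≤ (G + 1) * (ε / (2 * (G + 1))) := by
        rw [abs_of_nonneg (by linarith)]
        gcongr
        · linarith
        · linarith [hδ.2]
      _ = ε / 2 := by field_simp
  rw [← intervalIntegral.integral_add_adjacent_intervals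
    ((hh.mono (Icc_subset_Icc_right (hMt.trans ht.2))).intervalIntegrable_of_Icc hMδ)
    ((hh.mono (Icc_subset_Icc hMδ ht.2)).intervalIntegrable_of_Icc hMt), ← sub_sub]
  exact (abs_sub _ _).trans (by linarith)

end Riemann

theorem IsInfillLongSpan.tendsto_nhdsGT {Δ : ℕ → ℝ} (hΔ : IsInfillLongSpan Δ) :
    Tendsto Δ atTop (𝓝[>] 0) :=
  tendsto_nhdsWithin_iff.2 ⟨hΔ.infill, Eventually.of_forall hΔ.pos⟩

/-! ### Consistency of the estimator in `L^p` -/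

section Bias

variable {a : ℝ → ℝ} {Δ : ℝ} {n l : ℕ}

theorem IsTrawlFunction.lostArea_bounds (ha : IsTrawlFunction a) (hΔ : 0 ≤ Δ) (hl : l ≤ n) :
    (n - l) * (a (l * Δ + Δ) * Δ) ≤ lostArea (fun k => trawlSetAt a (k * Δ)) n l ∧
      lostArea (fun k => trawlSetAt a (k * Δ)) n l ≤ (n - l) * (a (l * Δ) * Δ) := by
  have hcard : ((Finset.Ico l n).card : ℝ) = n - l := by rw [Nat.card_Ico, Nat.cast_sub hl]
  have hterm (k : ℕ) (hk : k ∈ Finset.Ico l n) :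
      a (l * Δ + Δ) * Δ ≤ volume.real ((trawlSetAt a ((k - l : ℕ) * Δ) ∩ trawlSetAt a (k * Δ)) \
        trawlSetAt a ((k + 1 : ℕ) * Δ)) ∧
      volume.real ((trawlSetAt a ((k - l : ℕ) * Δ) ∩ trawlSetAt a (k * Δ)) \
        trawlSetAt a ((k + 1 : ℕ) * Δ)) ≤ a (l * Δ) * Δ := by
    have hpast : ((k - l : ℕ) : ℝ) * Δ ≤ k * Δ := by gcongr; exact Nat.sub_le k l
    have hnext : (k : ℝ) * Δ ≤ (k + 1 : ℕ) * Δ := by gcongr; exact k.le_succ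
    have hlag : (k : ℝ) * Δ - (k - l : ℕ) * Δ = l * Δ := by
      rw [Nat.cast_sub (Finset.mem_Ico.1 hk).1]
      ring
    have hstep : ((k + 1 : ℕ) : ℝ) * Δ - k * Δ = Δ := by
      push_cast
      ring
    have hlag_succ : ((k + 1 : ℕ) : ℝ) * Δ - (k - l : ℕ) * Δ = l * Δ + Δ := by
      rw [← hlag]
      push_cast
      ring
    have hlower := ha.le_volume_real_inter_sdiff hpast hnext
    have hupper := ha.volume_real_inter_sdiff_le hpast hnext
    rw [hlag_succ, hstep] at hlower
    rw [hlag, hstep] at hupper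
    exact ⟨hlower, hupper⟩
  have hlower := Finset.card_nsmul_le_sum _ _ _ fun k hk => (hterm k hk).1
  have hupper := Finset.sum_le_card_nsmul _ _ _ fun k hk => (hterm k hk).2
  rw [nsmul_eq_mul, hcard] at hlower hupper
  exact ⟨hlower, hupper⟩

theorem IsTrawlFunction.abs_lostArea_div_sub_le (ha : IsTrawlFunction a) (hΔ : 0 < Δ) (hn : 0 < n)
    (hl : l ≤ n) :
    |lostArea (fun k => trawlSetAt a (k * Δ)) n l / (n * Δ) - a (l * Δ)| ≤
      (a (l * Δ) - a (l * Δ + Δ)) + l * Δ * a 0 / (n * Δ) := by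
  obtain ⟨hlower, hupper⟩ := ha.lostArea_bounds hΔ.le hl
  have hN : 0 < n * Δ := by positivity
  have hl_nonneg : 0 ≤ l * Δ := by positivity
  have hl_succ : 0 ≤ l * Δ + Δ := by positivity
  have ha_nonneg := ha.nonneg _ hl_nonneg
  have ha_zero := ha.apply_zero_pos
  have ha_le : a (l * Δ + Δ) ≤ a 0 := ha.antitone self_mem_Ici hl_succ hl_succ
  have ha_step : a (l * Δ + Δ) ≤ a (l * Δ) := ha.antitone hl_nonneg hl_succ (by linarith)
  have hdiv_le : lostArea (fun k => trawlSetAt a (k * Δ)) n l / (n * Δ) ≤ a (l * Δ) := by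
    rw [div_le_iff₀ hN]
    linarith [mul_nonneg hl_nonneg ha_nonneg]
  have hle_div : a (l * Δ + Δ) - l * Δ * a 0 / (n * Δ) ≤
      lostArea (fun k => trawlSetAt a (k * Δ)) n l / (n * Δ) := by
    rw [le_div_iff₀ hN, sub_mul, div_mul_cancel₀ _ hN.ne']
    linarith [mul_le_mul_of_nonneg_left ha_le hl_nonneg]
  have hquot : 0 ≤ l * Δ * a 0 / (n * Δ) := by positivity
  exact abs_le.2 ⟨by linarith, by linarith [ha_step, hquot]⟩

theorem IsTrawlFunction.eventually_abs_lostArea_div_sub_le (ha : IsTrawlFunction a) {Δ : ℕ → ℝ}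
    (hΔ : IsInfillLongSpan Δ) (T : ℝ) {η : ℝ} (hη : 0 < η) :
    ∀ᶠ n in atTop, ∀ l : ℕ, l * Δ n ≤ T →
      |lostArea (fun k => trawlSetAt a (k * Δ n)) n l / (n * Δ n) - a (l * Δ n)| ≤ η := by
  have hosc := hΔ.tendsto_nhdsGT.eventually (eventually_abs_sub_le_of_continuousOn
    (T := T + 1) (ha.continuous.mono Icc_subset_Ici_self) (half_pos hη))
  have hvanish : Tendsto (fun n : ℕ => T * a 0 / (n * Δ n)) atTop (𝓝 0) :=
    tendsto_const_nhds.div_atTop hΔ.longSpan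
  filter_upwards [hosc, hΔ.infill.eventually_le_const one_pos, eventually_gt_atTop 0,
    hvanish.eventually_le_const (half_pos hη), hΔ.longSpan.eventually_ge_atTop T]
    with n hosc_n hΔ_le hn hedge hTn l hl
  have hpos := hΔ.pos n
  have hl_nonneg : 0 ≤ l * Δ n := by positivity
  have hln : l ≤ n := by exact_mod_cast le_of_mul_le_mul_right (hl.trans hTn) hpos
  have hstep : a (l * Δ n) - a (l * Δ n + Δ n) ≤ η / 2 :=
    (le_abs_self _).trans (hosc_n _ ⟨hl_nonneg, by linarith⟩ _ ⟨by linarith, by linarith⟩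
      (by simp [abs_of_pos hpos]))
  have hedge_l : l * Δ n * a 0 / (n * Δ n) ≤ T * a 0 / (n * Δ n) := by
    have := ha.apply_zero_pos
    gcongr
  linarith [ha.abs_lostArea_div_sub_le hpos hn hln]

end Bias

theorem aHat_eq_laggedSum {Ω : Type*} (X : ℝ → Ω → ℝ) (Δ : ℕ → ℝ) {n : ℕ} (hΔ : Δ n ≠ 0)
    (l : ℕ) (ω : Ω) :
    aHat X Δ n (l * Δ n) ω = -(1 / (n * Δ n)) * laggedSum n l (fun k => X (k * Δ n) ω) := by
  have hfloor : ⌊(l : ℝ) * Δ n / Δ n⌋₊ = l := by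
    rw [mul_div_cancel_right₀ _ hΔ, Nat.floor_natCast]
  simp only [aHat, laggedSum, sampleMean, hfloor]
  congr 1
  refine Finset.sum_congr rfl fun k hk => ?_
  rw [Nat.cast_sub (Finset.mem_Ico.1 hk).1, Nat.cast_succ]

theorem tendsto_abs_one_div_rpow_mul_moment {p c : ℝ} (D : ℝ) (hp : 2 ≤ p) (hc : 0 ≤ c) :
    Tendsto (fun x : ℝ => |1 / x| ^ p * (D * (1 + c * x + (c * x) ^ (p / 2)))) atTop (𝓝 0) := by
  have hconst := (tendsto_rpow_neg_atTop (by linarith : 0 < p)).const_mul D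
  have hlinear := (tendsto_rpow_neg_atTop (by linarith : 0 < p - 1)).const_mul (D * c)
  have hpower := (tendsto_rpow_neg_atTop (by linarith : 0 < p / 2)).const_mul (D * c ^ (p / 2))
  have hsum := (hconst.add hlinear).add hpower
  simp only [mul_zero, add_zero] at hsum
  refine hsum.congr' ?_
  filter_upwards [eventually_gt_atTop 0] with x hx
  have hinv : |1 / x| ^ p = x ^ (-p) := by
    rw [abs_of_pos (by positivity), one_div, Real.inv_rpow hx.le, Real.rpow_neg hx.le]
  have hlinear_exp : x ^ (-(p - 1)) = x ^ (-p) * x := by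
    rw [← Real.rpow_add_one hx.ne', neg_sub, sub_eq_neg_add]
  have hpower_exp : x ^ (-(p / 2)) = x ^ (-p) * x ^ (p / 2) := by
    rw [← Real.rpow_add hx]
    congr 1
    ring
  rw [hinv, hlinear_exp, hpower_exp, Real.mul_rpow hc hx.le]
  ring

section Consistency

variable {Ω : Type*} [MeasurableSpace Ω] {P : Measure Ω} [IsProbabilityMeasure P] {γ b : ℝ}
  {ν : Measure ℝ} {L : Set (ℝ × ℝ) → Ω → ℝ} {m p : ℝ} {a : ℝ → ℝ} {X : ℝ → Ω → ℝ} {Δ : ℕ → ℝ}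

theorem IsTrawlProcess.eventually_hasMomentLE_aHat_sub (hX : IsTrawlProcess P L a X)
    (hL : IsLevyBasis P γ b ν L) (hm : HasMoments P L m (2 * p)) (hp : 2 ≤ p)
    (ha : IsTrawlFunction a) (hΔ : IsInfillLongSpan Δ) (T : ℝ) {ε : ℝ} (hε : 0 < ε) :
    ∀ᶠ n in atTop, ∀ l : ℕ, l * Δ n ≤ T →
      HasMomentLE P p ε fun ω => aHat X Δ n (l * Δ n) ω - a (l * Δ n) := by
  obtain ⟨D, -, hmoment⟩ := hX.exists_hasMomentLE_laggedSum hL hm hp ha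
  set ε' := ε / 2 ^ p
  have hε' : 0 < ε' := by positivity
  have hvanish := ((tendsto_abs_one_div_rpow_mul_moment D hp ha.apply_zero_pos.le).comp
    hΔ.longSpan).eventually_le_const hε'
  have hbias := ha.eventually_abs_lostArea_div_sub_le hΔ T (η := ε' ^ p⁻¹) (by positivity)
  filter_upwards [hbias, hvanish, eventually_gt_atTop 0, hΔ.longSpan.eventually_ge_atTop T]
    with n hbias_n hvanish_n hn hTn l hl
  have hpos := hΔ.pos n
  have hln : l ≤ n := by exact_mod_cast le_of_mul_le_mul_right (hl.trans hTn) hpos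
  set W := lostArea (fun k => trawlSetAt a (k * Δ n)) n l
  have hbias_moment : HasMomentLE P p ε' fun _ => W / (n * Δ n) - a (l * Δ n) := by
    refine (HasMomentLE.const p _).mono ?_
    refine (Real.rpow_le_rpow (abs_nonneg _) (hbias_n l hl) (by linarith)).trans_eq ?_
    exact Real.rpow_inv_rpow hε'.le (by linarith)
  have hnoise_moment : HasMomentLE P p ε' fun ω =>
      1 / (n * Δ n) * (laggedSum n l (fun k => X (k * Δ n) ω) + W) := by
    refine ((hmoment n l (Δ n) hn hln hpos).const_mul (1 / (n * Δ n))).mono ?_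
    simpa only [Function.comp_apply, mul_left_comm (a 0) (n : ℝ)] using hvanish_n
  have hsub := hbias_moment.sub (by linarith) hnoise_moment
  rw [mul_div_cancel₀ ε (by positivity)] at hsub
  refine hsub.congr_ae (ae_of_all _ fun ω => ?_)
  simp only [aHat_eq_laggedSum X Δ hpos.ne']
  ring

end Consistency

/-! ### From the trawl function to its integrated functionals -/

section PolyGrowth

variable {g : ℝ → ℝ} {C q p : ℝ}

theorem abs_le_const_mul_rpow (hC : 0 ≤ C) (hgC : ∀ x, |g x| ≤ C * (1 + |x| ^ q)) (hq : 0 ≤ q)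
    (hqp : q ≤ p) {κ u z : ℝ} (hκ : 0 ≤ κ) (hu : 1 ≤ u) (hz : |z| ≤ κ * u) :
    |g z| ≤ C * (1 + κ ^ q) * u ^ p := by
  have hpow : |z| ^ q ≤ κ ^ q * u ^ p := by
    refine (Real.rpow_le_rpow (abs_nonneg z) hz hq).trans ?_
    rw [Real.mul_rpow hκ (by linarith)]
    gcongr
  calc |g z| ≤ C * (1 + |z| ^ q) := hgC z
    _ ≤ C * (u ^ p + κ ^ q * u ^ p) := by
      gcongr
      exact Real.one_le_rpow hu (hq.trans hqp)
    _ = C * (1 + κ ^ q) * u ^ p := by ring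

theorem exists_abs_sub_le_of_polyGrowth (hg : Continuous g) (hq : 0 ≤ q) (hqp : q ≤ p)
    (hgq : PolyGrowth g q) {A : ℝ} (hA : 0 ≤ A) {ε : ℝ} (hε : 0 < ε) :
    ∃ C, 0 < C ∧ ∀ x ∈ Icc 0 A, ∀ y, |g y - g x| ≤ ε + C * |y - x| ^ p := by
  obtain ⟨C, hC, hgC⟩ := hgq
  obtain ⟨d₀, hd₀, hclose⟩ := Metric.uniformContinuousOn_iff.1
    (isCompact_Icc.uniformContinuousOn_of_continuous (s := Icc (-1) (A + 1)) hg.continuousOn) ε hε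
  set d := min d₀ 1
  have hd : 0 < d := lt_min hd₀ one_pos
  have hd_le : d ≤ 1 := min_le_right _ _
  refine ⟨2 * (C * (1 + (1 + A) ^ q)) / d ^ p, by positivity, fun x hx y => ?_⟩
  rcases lt_or_ge |y - x| d with hnear | hfar
  · have hxy := abs_lt.1 (hnear.trans_le hd_le)
    have hg_near := hclose y ⟨by linarith [hx.1], by linarith [hx.2]⟩ x
      ⟨by linarith [hx.1], by linarith [hx.2]⟩ (hnear.trans_le (min_le_left _ _))
    exact hg_near.le.trans (le_add_of_nonneg_right (by positivity))
  · set u := |y - x| / d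
    have hu : 1 ≤ u := (one_le_div₀ hd).2 hfar
    have hxu : |x| ≤ (1 + A) * u := by
      rw [abs_of_nonneg hx.1]
      nlinarith [hx.2]
    have hyu : |y| ≤ (1 + A) * u := by
      have hdu : |y - x| ≤ u := le_div_self (abs_nonneg _) hd hd_le
      have hAu : A ≤ A * u := le_mul_of_one_le_right hA hu
      linarith [abs_sub_abs_le_abs_sub y x, abs_of_nonneg hx.1, hx.2]
    have hgx := abs_le_const_mul_rpow hC.le hgC hq hqp (by positivity) hu hxu
    have hgy := abs_le_const_mul_rpow hC.le hgC hq hqp (by positivity) hu hyu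
    calc |g y - g x| ≤ |g y| + |g x| := abs_sub _ _
      _ ≤ 2 * (C * (1 + (1 + A) ^ q)) * u ^ p := by linarith
      _ = 2 * (C * (1 + (1 + A) ^ q)) / d ^ p * |y - x| ^ p := by
        rw [Real.div_rpow (abs_nonneg _) hd.le]
        ring
      _ ≤ ε + 2 * (C * (1 + (1 + A) ^ q)) / d ^ p * |y - x| ^ p := by linarith

end PolyGrowth

section IntegratedError

variable {Ω : Type*} {X : ℝ → Ω → ℝ} {a g : ℝ → ℝ} {Δ : ℕ → ℝ} {p T : ℝ}

/-- The discretised integrated error `Δₙ ∑_{l < ⌊T/Δₙ⌋} |â(lΔₙ) - a(lΔₙ)|^p` of the estimator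
on `[0, T]`. -/
noncomputable def integratedError (X : ℝ → Ω → ℝ) (a : ℝ → ℝ) (Δ : ℕ → ℝ) (p T : ℝ) (n : ℕ)
    (ω : Ω) : ℝ :=
  Δ n * ∑ l ∈ Finset.range ⌊T / Δ n⌋₊, |aHat X Δ n (l * Δ n) ω - a (l * Δ n)| ^ p

theorem integratedError_nonneg {n : ℕ} (hΔ : 0 ≤ Δ n) (ω : Ω) :
    0 ≤ integratedError X a Δ p T n ω :=
  mul_nonneg hΔ (Finset.sum_nonneg fun _ _ => by positivity)

theorem IsTrawlFunction.abs_PsiHat_sub_sum_le (ha : IsTrawlFunction a) {η C : ℝ} (hη : 0 ≤ η)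
    (hC : 0 ≤ C) (hgC : ∀ x ∈ Icc 0 (a 0), ∀ y, |g y - g x| ≤ η + C * |y - x| ^ p) {n : ℕ}
    (hΔ : 0 < Δ n) {t : ℝ} (ht : t ∈ Icc 0 T) (ω : Ω) :
    |PsiHat X Δ g n t ω - Δ n * ∑ l ∈ Finset.range ⌊t / Δ n⌋₊, g (a (l * Δ n))| ≤
      η * T + C * integratedError X a Δ p T n ω := by
  set M := ⌊t / Δ n⌋₊
  set E : ℕ → ℝ := fun l => |aHat X Δ n (l * Δ n) ω - a (l * Δ n)| ^ p
  have hterm (l : ℕ) : |g (aHat X Δ n (l * Δ n) ω) - g (a (l * Δ n))| ≤ η + C * E l := by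
    have hl : 0 ≤ l * Δ n := by positivity
    exact hgC _ ⟨ha.nonneg _ hl, ha.antitone self_mem_Ici hl hl⟩ _
  have hsum_mono : ∑ l ∈ Finset.range M, E l ≤ ∑ l ∈ Finset.range ⌊T / Δ n⌋₊, E l := by
    refine Finset.sum_le_sum_of_subset_of_nonneg (Finset.range_subset_range.2 ?_)
      fun l _ _ => by positivity
    exact Nat.floor_mono (by gcongr; exact ht.2)
  have hMT : M * Δ n ≤ T := (floor_div_mul_le ht.1 hΔ).trans ht.2
  rw [PsiHat, ← mul_sub, ← Finset.sum_sub_distrib, abs_mul, abs_of_pos hΔ]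
  calc Δ n * |∑ l ∈ Finset.range M, (g (aHat X Δ n (l * Δ n) ω) - g (a (l * Δ n)))|
      ≤ Δ n * ∑ l ∈ Finset.range M, (η + C * E l) := by
        gcongr
        exact (Finset.abs_sum_le_sum_abs _ _).trans (Finset.sum_le_sum fun l _ => hterm l)
    _ = η * (M * Δ n) + C * (Δ n * ∑ l ∈ Finset.range M, E l) := by
        rw [Finset.sum_add_distrib, Finset.sum_const, Finset.card_range, nsmul_eq_mul,
          ← Finset.mul_sum]
        ring
    _ ≤ η * T + C * (Δ n * ∑ l ∈ Finset.range ⌊T / Δ n⌋₊, E l) := by gcongr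

theorem IsTrawlFunction.exists_abs_PsiHat_sub_Psi_le (ha : IsTrawlFunction a)
    (hΔ : IsInfillLongSpan Δ) (X : ℝ → Ω → ℝ) (hg : Continuous g) {q : ℝ} (hq : 0 ≤ q)
    (hqp : q ≤ p) (hgq : PolyGrowth g q) (hT : 0 < T) {ε : ℝ} (hε : 0 < ε) :
    ∃ C, 0 < C ∧ ∀ᶠ n in atTop, ∀ ω, ∀ t ∈ Icc 0 T,
      |PsiHat X Δ g n t ω - Psi a g t| ≤ ε + C * integratedError X a Δ p T n ω := by
  obtain ⟨C, hC, hgC⟩ := exists_abs_sub_le_of_polyGrowth hg hq hqp hgq ha.apply_zero_pos.le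
    (by positivity : 0 < ε / (2 * T))
  have hga : ContinuousOn (fun s => g (a s)) (Icc 0 T) :=
    hg.comp_continuousOn (ha.continuous.mono Icc_subset_Ici_self)
  refine ⟨C, hC, ?_⟩
  filter_upwards [hΔ.tendsto_nhdsGT.eventually
    (eventually_abs_riemannSum_sub_integral_le hT hga (half_pos hε))] with n hriemann ω t ht
  have hestimation : |PsiHat X Δ g n t ω - Δ n * ∑ l ∈ Finset.range ⌊t / Δ n⌋₊, g (a (l * Δ n))| ≤
      ε / (2 * T) * T + C * integratedError X a Δ p T n ω :=
    ha.abs_PsiHat_sub_sum_le (by positivity) hC.le hgC (hΔ.pos n) ht ω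
  have hεT : ε / (2 * T) * T = ε / 2 := by field_simp
  refine (abs_sub_le _ _ _).trans ((add_le_add hestimation (hriemann t ht)).trans_eq ?_)
  rw [hεT]
  ring

variable [MeasurableSpace Ω] {P : Measure Ω}

theorem IsTrawlProcess.eventually_integral_integratedError_le [IsProbabilityMeasure P] {γ b : ℝ}
    {ν : Measure ℝ} {L : Set (ℝ × ℝ) → Ω → ℝ} {m : ℝ} (hX : IsTrawlProcess P L a X)
    (hL : IsLevyBasis P γ b ν L) (hm : HasMoments P L m (2 * p)) (hp : 2 ≤ p)
    (ha : IsTrawlFunction a) (hΔ : IsInfillLongSpan Δ) (hT : 0 < T) {ε : ℝ} (hε : 0 < ε) :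
    ∀ᶠ n in atTop, Integrable (integratedError X a Δ p T n) P ∧
      ∫ ω, integratedError X a Δ p T n ω ∂P ≤ ε := by
  filter_upwards [hX.eventually_hasMomentLE_aHat_sub hL hm hp ha hΔ T (div_pos hε hT)] with n hn
  have hpos := hΔ.pos n
  set M := ⌊T / Δ n⌋₊
  have hMT : M * Δ n ≤ T := floor_div_mul_le hT.le hpos
  have hmoment (l : ℕ) (hl : l ∈ Finset.range M) := hn l <| hMT.trans' <| by
    gcongr
    exact (Finset.mem_range.1 hl).le
  have hint (l : ℕ) (hl : l ∈ Finset.range M) :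
      Integrable (fun ω => |aHat X Δ n (l * Δ n) ω - a (l * Δ n)| ^ p) P :=
    integrable_abs_rpow_of_memLp (by linarith) (hmoment l hl).memLp
  refine ⟨(integrable_finsetSum _ hint).const_mul _, ?_⟩
  simp only [integratedError]
  rw [integral_const_mul, integral_finsetSum _ hint]
  calc Δ n * ∑ l ∈ Finset.range M, ∫ ω, |aHat X Δ n (l * Δ n) ω - a (l * Δ n)| ^ p ∂P
      ≤ Δ n * (M * (ε / T)) := by
        gcongr
        have hsum := Finset.sum_le_card_nsmul _ _ _ fun l hl => (hmoment l hl).integral_le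
        rwa [Finset.card_range, nsmul_eq_mul] at hsum
    _ = M * Δ n * (ε / T) := by ring
    _ ≤ T * (ε / T) := by gcongr
    _ = ε := mul_div_cancel₀ ε hT.ne'

end IntegratedError

theorem setOf_le_iSup_edist_subset {Ω : Type*} {T C : ℝ} {r : ℝ≥0} {ε : ℝ≥0∞} {Y Y' : ℝ → Ω → ℝ}
    {R : Ω → ℝ} (hrε : r ≤ ε) (hC : 0 < C) (hR : ∀ ω, 0 ≤ R ω)
    (hdom : ∀ ω, ∀ t ∈ Icc 0 T, |Y t ω - Y' t ω| ≤ r / 2 + C * R ω) :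
    {ω | ε ≤ ⨆ t ∈ Icc 0 T, edist (Y t ω) (Y' t ω)} ⊆ {ω | r / 2 / C ≤ R ω} := by
  intro ω hω
  have hsup : ⨆ t ∈ Icc 0 T, edist (Y t ω) (Y' t ω) ≤ ENNReal.ofReal (r / 2 + C * R ω) :=
    iSup₂_le fun t ht => by
      rw [edist_dist]
      exact ENNReal.ofReal_le_ofReal (hdom ω t ht)
  have hr_le : (r : ℝ) ≤ r / 2 + C * R ω := by
    have hle := hrε.trans (hω.trans hsup)
    have := hR ω
    rwa [← ENNReal.ofReal_coe_nnreal, ENNReal.ofReal_le_ofReal_iff (by positivity)] at hle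
  exact (div_le_iff₀' hC).2 (by linarith)

theorem tendstoUCP_of_abs_sub_le {Ω : Type*} [MeasurableSpace Ω] {P : Measure Ω}
    [IsFiniteMeasure P] {Z : ℕ → ℝ → Ω → ℝ} {Z' : ℝ → Ω → ℝ} (Q : ℝ → ℕ → Ω → ℝ)
    (hQ_nonneg : ∀ T n ω, 0 ≤ Q T n ω)
    (hQ : ∀ T, 0 < T → ∀ ε, 0 < ε →
      ∀ᶠ n in atTop, Integrable (Q T n) P ∧ ∫ ω, Q T n ω ∂P ≤ ε)
    (hZ : ∀ T, 0 < T → ∀ ε, 0 < ε → ∃ C, 0 < C ∧ ∀ᶠ n in atTop, ∀ ω, ∀ t ∈ Icc 0 T,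
      |Z n t ω - Z' t ω| ≤ ε + C * Q T n ω) :
    TendstoUCP P Z Z' := by
  intro T hT ε hε
  obtain ⟨r, hr_pos, hrε⟩ := ENNReal.lt_iff_exists_nnreal_btwn.1 hε
  have hr : (0 : ℝ) < r := by exact_mod_cast hr_pos
  obtain ⟨C, hC, hdom⟩ := hZ T hT (r / 2) (half_pos hr)
  set θ : ℝ := r / 2 / C
  have hθ : 0 < θ := by positivity
  refine ENNReal.tendsto_nhds_zero.2 fun δ hδ => ?_
  obtain ⟨s, hs_pos, hsδ⟩ := ENNReal.lt_iff_exists_nnreal_btwn.1 hδ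
  have hs : (0 : ℝ) < s := by exact_mod_cast hs_pos
  filter_upwards [hdom, hQ T hT (θ * s) (by positivity)] with n hn ⟨hQ_int, hQ_le⟩
  have hmarkov : P.real {ω | θ ≤ Q T n ω} ≤ s := by
    have := mul_meas_ge_le_integral_of_nonneg (ae_of_all _ (hQ_nonneg T n)) hQ_int θ
    exact le_of_mul_le_mul_left (this.trans hQ_le) hθ
  calc P {ω | ε ≤ ⨆ t ∈ Icc 0 T, edist (Z n t ω) (Z' t ω)} ≤ P {ω | θ ≤ Q T n ω} :=
        measure_mono (setOf_le_iSup_edist_subset hrε.le hC (hQ_nonneg T n) hn)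
    _ = ENNReal.ofReal (P.real {ω | θ ≤ Q T n ω}) := (ofReal_measureReal).symm
    _ ≤ s := by
        rw [← ENNReal.ofReal_coe_nnreal]
        exact ENNReal.ofReal_le_ofReal hmarkov
    _ ≤ δ := hsδ.le

end Trawl

theorem theorem1 {Ω : Type*} [MeasurableSpace Ω] (P : Measure Ω) [IsProbabilityMeasure P]
    -- homogeneous Lévy basis with triplet `(γ, b, ν)`, and the law `seed` of its Lévy seed `L'`
    (γ b : ℝ) (ν : Measure ℝ) (L : Set (ℝ × ℝ) → Ω → ℝ) (hL : Trawl.IsLevyBasis P γ b ν L)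
    (seed : Measure ℝ) (hseed : Trawl.IsSeedLaw γ b ν seed) (hvar : variance id seed = 1)
    -- trawl function and trawl process
    (a : ℝ → ℝ) (ha : Trawl.IsTrawlFunction a)
    (X : ℝ → Ω → ℝ) (hX : Trawl.IsTrawlProcess P L a X)
    -- sampling scheme
    (Δ : ℕ → ℝ) (hΔ : Trawl.IsInfillLongSpan Δ)
    -- test function
    (g : ℝ → ℝ) (hg : Continuous g) (q : ℝ) (hq : 0 ≤ q) (hgq : Trawl.PolyGrowth g q)
    -- `E|L'|^{2q ∨ 4} < ∞`
    (hmom : Integrable (fun x : ℝ => |x| ^ (max (2 * q) 4)) seed) :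
    Trawl.TendstoUCP P (Trawl.PsiHat X Δ g) (fun t _ => Trawl.Psi a g t) := by
  set p := max q 2
  have hp : 2 ≤ p := le_max_right q 2
  have hexponent : max (2 * q) 4 = 2 * p := by
    rw [mul_max_of_nonneg _ _ zero_le_two]
    norm_num
  rw [hexponent] at hmom
  have hmemLp : MemLp id (ENNReal.ofReal (2 * p)) seed :=
    (Trawl.memLp_iff_integrable_abs_rpow measurable_id.aestronglyMeasurable (by linarith)).2 hmom
  have hm : Trawl.HasMoments P L (∫ x, x ∂seed) (2 * p) :=
    hL.hasMoments hseed hvar (by linarith) hmemLp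
  exact Trawl.tendstoUCP_of_abs_sub_le (fun T => Trawl.integratedError X a Δ p T)
    (fun _ n => Trawl.integratedError_nonneg (hΔ.pos n).le)
    (fun _ hT _ hε => hX.eventually_integral_integratedError_le hL hm hp ha hΔ hT hε)
    (fun _ hT _ hε => ha.exists_abs_PsiHat_sub_Psi_le hΔ X hg hq (le_max_left q 2) hgq hT hε)
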